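/- Let $\xi_1,\xi_2$ be two independent Gaussian white noises in the real Hilbert space $L_2([0;1])$, defined on a probability space, i.e. two independent centered Gaussian families $(h,\xi_j)$, $h\in L_2([0;1])$, with $E(h,\xi_j)(h',\xi_j)=\langle h,h'\rangle$. Let $A$ be a continuous linear operator in $L_2([0;1])$ such that 1) $\dim\operatorname{Ker}A<+\infty$; 2) the restriction of $A$ to the orthogonal complement of $\operatorname{Ker}A$ is continuously invertible as an operator onto the range of $A$. Put $g(t)=A\mathbf 1_{[0;t]}$ and let $x(t)=((g(t),\xi_1),(g(t),\xi_2))$, $t\in[0;1]$, be (a jointly measurable version of) the planar Gaussian integrator generated by $A$. Let $k\ge 2$, $\delta>0$ and $$\Delta_k^\delta=\{\vec t=(t_1,\dots,t_k):\ 0\le t_1\le\dots\le t_k\le 1,\ t_{i+1}-t_i\ge\delta,\ i=1,\dots,k-1\}.$$ Write $\Delta g(t_i)=g(t_{i+1})-g(t_i)$, let $G(\vec t)$ be the Gram determinant of $\Delta g(t_1),\dots,\Delta g(t_{k-1})$, and let $P_{t_1\ldots t_k}$ be the orthogonal projection onto their linear span. For $\varepsilon>0$ put $f_\varepsilon(z)=\frac1{2\pi\varepsilon}e^{-\|z\|^2/(2\varepsilon)}$,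 $z\in\mathbb R^2$, and $$T^x_{\varepsilon,k,\delta}=\int_{\Delta_k^\delta}\prod_{i=1}^{k-1}f_\varepsilon(x(t_{i+1})-x(t_i))\,d\vec t .$$ For a square integrable random variable $\alpha$ let $\mathcal T(\alpha)(h_1,h_2)=E\,\alpha\, e^{(h_1,\xi_1)+(h_2,\xi_2)-\frac12(\|h_1\|^2+\|h_2\|^2)}$ be its Fourier–Wiener transform. Then the Fourier–Wiener transform of the $k$-multiple self-intersection local time of $x$ exists on $\Delta_k^\delta$: the random variables $T^x_{\varepsilon,k,\delta}$ are well defined and square integrable, with $T^x_{\varepsilon,k,\delta}\,e^{(h_1,\xi_1)+(h_2,\xi_2)-\frac12(\|h_1\|^2+\|h_2\|^2)}$ integrable for all $h_1,h_2\in L_2([0;1])$; $G(\vec t)>0$ for almost every $\vec t\in\Delta_k^\delta$; and for all $h_1,h_2\in L_2([0;1])$ the integral $$\int_{\Delta_k^\delta}\frac{1}{(2\pi)^{k-1}G(\vec t)}\,e^{-\frac12\left(\|P_{t_1\ldots t_k}h_1\|^2+\|P_{t_1\ldots t_k}h_2\|^2\right)}d\vec t$$ converges, and $$\lim_{\varepsilon\to0+}\mathcal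 T(T^x_{\varepsilon,k,\delta})(h_1,h_2)=\int_{\Delta_k^\delta}\frac{1}{(2\pi)^{k-1}G(\vec t)}\,e^{-\frac12\left(\|P_{t_1\ldots t_k}h_1\|^2+\|P_{t_1\ldots t_k}h_2\|^2\right)}d\vec t .$$ -/

import Mathlib

open MeasureTheory ProbabilityTheory Filter Topology

noncomputable section

namespace SILT

/-- The real Hilbert space `L₂([0;1])`. -/
abbrev L2 : Type := Lp ℝ 2 (volume.restrict (Set.Icc (0 : ℝ) 1))

/-- The plane `ℝ²` with its Euclidean norm. -/
abbrev Plane : Type := EuclideanSpace ℝ (Fin 2)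

/-- The indicator of `[0;t]` as an element of `L₂([0;1])`. -/
def ind (t : ℝ) : L2 :=
  indicatorConstLp 2 (measurableSet_Icc : MeasurableSet (Set.Icc (0 : ℝ) t))
    (measure_ne_top (volume.restrict (Set.Icc (0 : ℝ) 1)) _) (1 : ℝ)

/-- A Gaussian white noise in `L₂([0;1])`: a centered Gaussian family of random variables
`(h, ξ) = ξ h`, indexed by `h ∈ L₂([0;1])`, with covariance `E (h₁, ξ)(h₂, ξ) = ⟨h₁, h₂⟩`. -/
structure IsWhiteNoise {Ω : Type*} [MeasurableSpace Ω] (μ : Measure Ω)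
    (ξ : L2 → Ω → ℝ) : Prop where
  measurable : ∀ h, Measurable (ξ h)
  gaussian : IsGaussianProcess ξ μ
  mean_zero : ∀ h, ∫ ω, ξ h ω ∂μ = 0
  covariance : ∀ h₁ h₂, ∫ ω, ξ h₁ ω * ξ h₂ ω ∂μ = inner ℝ h₁ h₂

/-- Two white noises are independent: the `σ`-algebras generated by the two families are. -/
def IndepNoises {Ω : Type*} [MeasurableSpace Ω] (μ : Measure Ω) (ξ₁ ξ₂ : L2 → Ω → ℝ) : Prop :=
  IndepFun (fun ω (h : L2) => ξ₁ h ω) (fun ω (h : L2) => ξ₂ h ω) μ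

/-- The function `g(t) = A 𝟙_[0;t]`, with values in `L₂([0;1])`. -/
def gfun (A : L2 →L[ℝ] L2) (t : ℝ) : L2 := A (ind t)

/-- `x` is (a jointly measurable version of) the planar Gaussian integrator
`x(t) = ((A 𝟙_[0;t], ξ₁), (A 𝟙_[0;t], ξ₂))`, `t ∈ [0;1]`. As the white noises are only defined
up to null sets at each element of `L₂([0;1])`, a measurable version has to be fixed in order to
integrate functions of the trajectories in `t`. -/
structure IsPlanarIntegrator {Ω : Type*} [MeasurableSpace Ω] (μ : Measure Ω)
    (ξ₁ ξ₂ : L2 → Ω → ℝ) (A : L2 →L[ℝ] L2) (x : ℝ → Ω → Plane) : Prop where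
  measurable : Measurable (fun p : ℝ × Ω => x p.1 p.2)
  version : ∀ t ∈ Set.Icc (0 : ℝ) 1,
    ∀ᵐ ω ∂μ, x t ω = !₂[ξ₁ (gfun A t) ω, ξ₂ (gfun A t) ω]

/-- The restriction of `A` to the orthogonal complement of its kernel is a continuously
invertible operator (onto its image, which is the range of `A`). -/
def InvertibleOffKernel (A : L2 →L[ℝ] L2) : Prop :=
  ∃ e : ↥((LinearMap.ker (A : L2 →ₗ[ℝ] L2))ᗮ) ≃L[ℝ] ↥(LinearMap.range (A : L2 →ₗ[ℝ] L2)),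
    ∀ f : ↥((LinearMap.ker (A : L2 →ₗ[ℝ] L2))ᗮ), (e f : L2) = A (f : L2)

/-- Position of the left end `t_i` of the `i`-th increment (all indices start at `0`). -/
def lo {k : ℕ} (i : Fin (k - 1)) : Fin k := ⟨i.1, by have := i.2; omega⟩

/-- Position of the right end `t_{i+1}` of the `i`-th increment. -/
def hi {k : ℕ} (i : Fin (k - 1)) : Fin k := ⟨i.1 + 1, by have := i.2; omega⟩

/-- The simplex `Δ_k = {0 ≤ t_1 ≤ … ≤ t_k ≤ 1}`. -/
def simplex (k : ℕ) : Set (Fin k → ℝ) :=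
  {t | (∀ i, t i ∈ Set.Icc (0 : ℝ) 1) ∧ Monotone t}

/-- The part `Δ_k^δ = {t ∈ Δ_k : t_{i+1} - t_i ≥ δ}` of the simplex off the diagonals. -/
def offDiag (k : ℕ) (δ : ℝ) : Set (Fin k → ℝ) :=
  {t | t ∈ simplex k ∧ ∀ i : Fin (k - 1), δ ≤ t (hi i) - t (lo i)}

/-- The increments `Δg(t_1), …, Δg(t_{k-1})`. -/
def incr (A : L2 →L[ℝ] L2) {k : ℕ} (t : Fin k → ℝ) (i : Fin (k - 1)) : L2 :=
  gfun A (t (hi i)) - gfun A (t (lo i))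

/-- The Gram determinant `G(Δg(t_1), …, Δg(t_{k-1}))`. -/
def gramDet (A : L2 →L[ℝ] L2) {k : ℕ} (t : Fin k → ℝ) : ℝ :=
  (Matrix.gram ℝ (incr A t)).det

/-- The linear span of `Δg(t_1), …, Δg(t_{k-1})`. -/
def incrSpan (A : L2 →L[ℝ] L2) {k : ℕ} (t : Fin k → ℝ) : Submodule ℝ L2 :=
  Submodule.span ℝ (Set.range (incr A t))

instance incrSpan.finiteDimensional (A : L2 →L[ℝ] L2) {k : ℕ} (t : Fin k → ℝ) :
    FiniteDimensional ℝ (incrSpan A t) :=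
  FiniteDimensional.span_of_finite ℝ (Set.finite_range _)

/-- The integrand of the formal Fourier-Wiener transform of the `k`-multiple self-intersection
local time, with `P_{t_1…t_k}` the orthogonal projection onto the span of the increments. -/
def formalIntegrand (A : L2 →L[ℝ] L2) {k : ℕ} (h₁ h₂ : L2) (t : Fin k → ℝ) : ℝ :=
  1 / ((2 * Real.pi) ^ (k - 1) * gramDet A t) *
    Real.exp (-(1 / 2) * (‖(incrSpan A t).starProjection h₁‖ ^ 2 +
      ‖(incrSpan A t).starProjection h₂‖ ^ 2))

/-- The Gaussian density `f_ε(z) = (2πε)⁻¹ exp(-‖z‖² / (2ε))` on the plane, which approximates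
the delta function at `0`. -/
def heat (ε : ℝ) (z : Plane) : ℝ :=
  1 / (2 * Real.pi * ε) * Real.exp (-‖z‖ ^ 2 / (2 * ε))

/-- The product `∏ f_ε(x(t_{i+1}) - x(t_i))` over the increments of a trajectory `y`. -/
def approxIntegrand (ε : ℝ) (y : ℝ → Plane) {k : ℕ} (t : Fin k → ℝ) : ℝ :=
  ∏ i : Fin (k - 1), heat ε (y (t (hi i)) - y (t (lo i)))

/-- The approximating random variable `T^x_{ε,k,δ} = ∫_{Δ_k^δ} ∏ f_ε(x(t_{i+1}) - x(t_i)) dt`. -/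
def approxSILT {Ω : Type*} (x : ℝ → Ω → Plane) (k : ℕ) (δ ε : ℝ) (ω : Ω) : ℝ :=
  ∫ t in offDiag k δ, approxIntegrand ε (fun s => x s ω) t

/-- The stochastic exponential `exp((h₁, ξ₁) + (h₂, ξ₂) - (‖h₁‖² + ‖h₂‖²) / 2)`. -/
def stochExp {Ω : Type*} (ξ₁ ξ₂ : L2 → Ω → ℝ) (h₁ h₂ : L2) (ω : Ω) : ℝ :=
  Real.exp (ξ₁ h₁ ω + ξ₂ h₂ ω - 1 / 2 * (‖h₁‖ ^ 2 + ‖h₂‖ ^ 2))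

/-- The Fourier-Wiener transform of a random variable `α`, at `(h₁, h₂)`. -/
def fourierWiener {Ω : Type*} [MeasurableSpace Ω] (μ : Measure Ω) (ξ₁ ξ₂ : L2 → Ω → ℝ)
    (α : Ω → ℝ) (h₁ h₂ : L2) : ℝ :=
  ∫ ω, α ω * stochExp ξ₁ ξ₂ h₁ h₂ ω ∂μ

end SILT

end

/-!
The theorem has a geometric half, the integrability of `1 / G` off the diagonals, and a
probabilistic half, the convergence of the transforms at fixed times. They meet in the dominated
convergence theorem, with `(2π)^{-(k-1)} / G` dominating the transforms of the integrands.

**Integrability of `1 / G`.** The Gram determinant can vanish where a step function with jumps at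
the `t_i` lies in `K = Ker A`. That `K` is finite-dimensional controls how fast it vanishes. For
each `t` there is a vector `ψ ⟂ K` which is orthogonal to all `𝟙_[0;r]` with `|r - t| ≥ δ` and
satisfies `⟨ψ, 𝟙_[0;t]⟩ = ‖ψ‖²`. Near a given point `s` it is obtained from `𝟙_[0;t] - 𝟙_[0;s]`
by removing the projection to a finite-dimensional space. As the rescaled increments
`(𝟙_[0;t] - 𝟙_[0;s]) / √|t - s|` converge weakly to `0`, this costs at most half of the squared
norm `|t - s|` (`eventually_exists_isDual`). By compactness of `[0;1]` there is a finite set `S`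
with `ρ(t) ≤ 2 ‖ψ‖²` for all `t`, where `ρ` is the distance to `S`
(`exists_finset_forall_exists_isDual`).

Testing a combination `u = ∑ b_j 𝟙_[0;t_j]` against these vectors gives
`c ρ(t_i) b_i² ≤ ‖A u‖²` for each `i`, since `A` is bounded below on the complement of `K`. The
coefficients `b_i`, with any one of them left out, are coordinates on the combinations of
increments, so that monotonicity of the determinant yields `G ≥ c ∏_{i ≠ j} ρ(t_i)` for each `j`
(`exists_finset_prod_succAbove_le_gramDet`). Taking the geometric mean over `j` gives
`1 / G ≤ C ∏ ρ(t_i)^{-(k-1)/k}`, which is integrable because the exponent exceeds `-1`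
(`exists_integrableOn_inv_gramDet_le`).

**Transforms at fixed times.** By independence the transform of `∏ f_ε(x(t_{i+1}) - x(t_i))`
factors over the two noises. For one noise, expand the increments in an orthonormal basis of their
span: the noise has independent standard normal coordinates there, the component of `h` orthogonal
to the span contributes a factor one, and what remains is a Lebesgue integral in which the
substitution `z = √ε M⁻¹ y` makes the bound and the limit as `ε → 0` visible
(`IsWhiteNoise.integral_prod_lineHeat`).
-/

noncomputable section

namespace SILT

/-! ### The curve of indicators -/

lemma inner_ind {a b : ℝ} (ha : a ∈ Set.Icc (0 : ℝ) 1) (hb : b ∈ Set.Icc (0 : ℝ) 1) :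
    inner ℝ (ind a) (ind b) = min a b := by
  unfold ind
  rw [L2.inner_indicatorConstLp_indicatorConstLp]
  have h : Set.Icc 0 a ∩ Set.Icc 0 b ∩ Set.Icc (0 : ℝ) 1 = Set.Icc 0 (min a b) := by
    ext x
    simp only [Set.mem_inter_iff, Set.mem_Icc, le_min_iff]
    have := ha.2
    constructor
    · rintro ⟨⟨⟨h1, h2⟩, -, h3⟩, -, -⟩
      exact ⟨h1, h2, h3⟩
    · rintro ⟨h1, h2, h3⟩
      exact ⟨⟨⟨h1, h2⟩, h1, h3⟩, h1, by linarith⟩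
  rw [Measure.real, Measure.restrict_apply (measurableSet_Icc.inter measurableSet_Icc), h]
  rw [Real.volume_Icc, sub_zero, ENNReal.toReal_ofReal (le_min ha.1 hb.1)]
  simp

lemma norm_ind_sub_sq {s t : ℝ} (hs : s ∈ Set.Icc (0 : ℝ) 1) (ht : t ∈ Set.Icc (0 : ℝ) 1) :
    ‖ind t - ind s‖ ^ 2 = |t - s| := by
  rw [@norm_sub_sq_real, ← real_inner_self_eq_norm_sq, ← real_inner_self_eq_norm_sq,
    inner_ind ht ht, inner_ind hs hs, inner_ind ht hs, min_self, min_self]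
  rcases le_total s t with h | h
  · rw [min_eq_right h, abs_of_nonneg (by linarith)]; ring
  · rw [min_eq_left h, abs_of_nonpos (by linarith)]; ring

/-- The rescaled increments `(𝟙_[0;t] - 𝟙_[0;s]) / √|t - s|` converge weakly to `0` as `t → s`.
They pair with an indicator to at most `√|t - s|`, and they have norm one, so that the pairing
with a vector in the closed span of the indicators is controlled by approximation. -/
lemma eventually_abs_inner_ind_sub_le {s : ℝ} (hs : s ∈ Set.Icc (0 : ℝ) 1) (w : L2) {ε : ℝ}
    (hε : 0 < ε) :
    ∀ᶠ t in 𝓝[Set.Icc 0 1] s, |inner ℝ (ind t - ind s) w| ≤ ε * √|t - s| := by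
  set U : Submodule ℝ L2 := Submodule.span ℝ (ind '' Set.Icc 0 1) with hU
  have key : ∀ u ∈ U, ∃ C : ℝ, 0 ≤ C ∧
      ∀ t ∈ Set.Icc (0 : ℝ) 1, |inner ℝ (ind t - ind s) u| ≤ C * |t - s| := by
    intro u hu
    induction hu using Submodule.span_induction with
    | mem x hx =>
      obtain ⟨r, hr, rfl⟩ := hx
      refine ⟨1, zero_le_one, fun t ht => ?_⟩
      rw [inner_sub_left, inner_ind ht hr, inner_ind hs hr, one_mul]
      exact (abs_min_sub_min_le_max t r s r).trans (by simp)
    | zero => exact ⟨0, le_rfl, fun t _ => by simp⟩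
    | add x y _ _ hx hy =>
      obtain ⟨C, hC, h⟩ := hx
      obtain ⟨D, hD, h'⟩ := hy
      refine ⟨C + D, by positivity, fun t ht => ?_⟩
      rw [inner_add_right, add_mul]
      exact (abs_add_le _ _).trans (add_le_add (h t ht) (h' t ht))
    | smul a x _ hx =>
      obtain ⟨C, hC, h⟩ := hx
      refine ⟨|a| * C, by positivity, fun t ht => ?_⟩
      rw [inner_smul_right, abs_mul, mul_assoc]
      exact mul_le_mul_of_nonneg_left (h t ht) (abs_nonneg a)
  set V : Submodule ℝ L2 := U.topologicalClosure with hV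
  have : CompleteSpace V := (Submodule.isClosed_topologicalClosure U).completeSpace_coe
  have hmem : ∀ t ∈ Set.Icc (0 : ℝ) 1, ind t - ind s ∈ V := fun t ht =>
    U.le_topologicalClosure (U.sub_mem (Submodule.subset_span ⟨t, ht, rfl⟩)
      (Submodule.subset_span ⟨s, hs, rfl⟩))
  have hw : V.starProjection w ∈ closure (U : Set L2) := V.starProjection_apply_mem w
  obtain ⟨u, hu, hdist⟩ := Metric.mem_closure_iff.1 hw (ε / 2) (half_pos hε)
  obtain ⟨C, hC, hCu⟩ := key u hu
  have hlim : Tendsto (fun t : ℝ => C * √|t - s|) (𝓝[Set.Icc 0 1] s) (𝓝 0) := by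
    have : Continuous fun t : ℝ => C * √|t - s| := by fun_prop
    simpa using (this.tendsto s).mono_left nhdsWithin_le_nhds
  filter_upwards [hlim.eventually (gt_mem_nhds (half_pos hε)), self_mem_nhdsWithin] with t h1 ht
  have hn : ‖ind t - ind s‖ = √|t - s| := by
    rw [← norm_ind_sub_sq hs ht, Real.sqrt_sq (norm_nonneg _)]
  have e1 : inner ℝ (ind t - ind s) w = inner ℝ (ind t - ind s) u
      + inner ℝ (ind t - ind s) (V.starProjection w - u) := by
    rw [← inner_add_right, add_sub_cancel, ← Submodule.inner_starProjection_left_eq_right,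
      Submodule.starProjection_eq_self_iff.2 (hmem t ht)]
  rw [e1]
  refine (abs_add_le _ _).trans ?_
  have e2 := hCu t ht
  have e3 := abs_real_inner_le_norm (ind t - ind s) (V.starProjection w - u)
  rw [hn, ← dist_eq_norm] at e3
  have e4 : |t - s| = √|t - s| * √|t - s| := (Real.mul_self_sqrt (abs_nonneg _)).symm
  have e5 := Real.sqrt_nonneg |t - s|
  have e6 : √|t - s| * dist (V.starProjection w) u ≤ √|t - s| * (ε / 2) :=
    mul_le_mul_of_nonneg_left hdist.le e5
  have e7 : C * |t - s| ≤ ε / 2 * √|t - s| := by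
    calc _ = C * √|t - s| * √|t - s| := by rw [mul_assoc, ← e4]
      _ ≤ _ := mul_le_mul_of_nonneg_right h1.le e5
  linarith

/-- Hence a finite-dimensional subspace captures asymptotically nothing of the increment
`𝟙_[0;t] - 𝟙_[0;s]` as `t → s`. -/
lemma eventually_norm_starProjection_ind_sub_sq_le {s : ℝ} (hs : s ∈ Set.Icc (0 : ℝ) 1)
    (W : Submodule ℝ L2) [FiniteDimensional ℝ W] :
    ∀ᶠ t in 𝓝[Set.Icc 0 1] s, 2 * ‖W.starProjection (ind t - ind s)‖ ^ 2 ≤ |t - s| := by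
  set m := Module.finrank ℝ W
  set b := stdOrthonormalBasis ℝ W
  set ε : ℝ := √(1 / (2 * (m + 1)))
  have hε : 0 < ε := by positivity
  have hε2 : ε ^ 2 = 1 / (2 * (m + 1)) := Real.sq_sqrt (by positivity)
  have h : ∀ᶠ t in 𝓝[Set.Icc 0 1] s, ∀ i, |inner ℝ (ind t - ind s) (b i : L2)| ≤ ε * √|t - s| :=
    eventually_all.2 fun i => eventually_abs_inner_ind_sub_le hs _ hε
  filter_upwards [h] with t ht
  have e1 : ‖W.starProjection (ind t - ind s)‖ ^ 2
      = ∑ i, ‖inner ℝ (b i) (W.orthogonalProjectionOnto (ind t - ind s))‖ ^ 2 := by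
    rw [b.sum_sq_norm_inner_right, Submodule.starProjection_apply]; rfl
  have e2 : ∀ i, ‖inner ℝ (b i) (W.orthogonalProjectionOnto (ind t - ind s))‖ ^ 2
      ≤ ε ^ 2 * |t - s| := by
    intro i
    have e3 : inner ℝ (b i) (W.orthogonalProjectionOnto (ind t - ind s))
        = inner ℝ (ind t - ind s) (b i : L2) := by
      rw [real_inner_comm, Submodule.inner_orthogonalProjectionOnto_eq_of_mem_right]
    calc _ ≤ (ε * √|t - s|) ^ 2 := by
          rw [e3]; exact pow_le_pow_left₀ (norm_nonneg _) (ht i) 2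
      _ = _ := by rw [mul_pow, Real.sq_sqrt (abs_nonneg _)]
  have e5 := Finset.sum_le_sum fun i (_ : i ∈ Finset.univ) => e2 i
  rw [← e1, Finset.sum_const, Finset.card_univ, Fintype.card_fin, nsmul_eq_mul, hε2] at e5
  have e6 : (m : ℝ) * (1 / (2 * (m + 1)) * |t - s|) * 2 ≤ |t - s| := by
    have : (m : ℝ) * (1 / (2 * (m + 1)) * |t - s|) * 2 = m / (m + 1) * |t - s| := by
      field_simp
    rw [this]
    exact mul_le_of_le_one_left (abs_nonneg _) ((div_le_one (by positivity)).2 (by linarith))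
  change _ ≤ (m : ℝ) * _ at e5
  linarith

/-! ### Dual vectors -/

/-- `IsDual K δ t ψ`: the vector `ψ` is orthogonal to `K`, and among the indicators `𝟙_[0;r]`
whose end point is `t` itself or at distance at least `δ` from `t` it only sees `𝟙_[0;t]`. -/
structure IsDual (K : Submodule ℝ L2) (δ t : ℝ) (ψ : L2) : Prop where
  inner_of_mem : ∀ κ ∈ K, inner ℝ ψ κ = 0
  inner_ind_of_le : ∀ r ∈ Set.Icc (0 : ℝ) 1, δ ≤ |r - t| → inner ℝ ψ (ind r) = 0
  inner_ind_self : inner ℝ ψ (ind t) = ‖ψ‖ ^ 2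

/-- Near `s`, a dual vector is obtained from `𝟙_[0;t] - 𝟙_[0;s]` by removing its component in a
finite-dimensional space `W`. With `E` the closed span of the increments between points close
to `s`, all indicators with end point far to the left of `s` are orthogonal to `E`, and all those
with end point far to the right have the same projection to `E` as `𝟙_[0;1]`; so
`W = P_E (K + span (𝟙_[0;s], 𝟙_[0;1]))` does. -/
lemma eventually_exists_isDual (K : Submodule ℝ L2) [FiniteDimensional ℝ K] {δ : ℝ} (hδ : 0 < δ)
    {s : ℝ} (hs : s ∈ Set.Icc (0 : ℝ) 1) :
    ∀ᶠ t in 𝓝[Set.Icc 0 1] s, ∃ ψ, IsDual K δ t ψ ∧ |t - s| ≤ 2 * ‖ψ‖ ^ 2 := by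
  set I : Set ℝ := {a | a ∈ Set.Icc (0 : ℝ) 1 ∧ |a - s| < δ / 2} with hI
  set E₀ : Submodule ℝ L2 := Submodule.span ℝ ((fun p : ℝ × ℝ => ind p.2 - ind p.1) '' (I ×ˢ I))
  set E : Submodule ℝ L2 := E₀.topologicalClosure
  have : CompleteSpace E := (Submodule.isClosed_topologicalClosure E₀).completeSpace_coe
  have hsI : s ∈ I := ⟨hs, by simpa using half_pos hδ⟩
  have h1 : (1 : ℝ) ∈ Set.Icc (0 : ℝ) 1 := ⟨zero_le_one, le_rfl⟩
  have hE : ∀ a ∈ I, ∀ b ∈ I, ind b - ind a ∈ E := fun a ha b hb =>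
    E₀.le_topologicalClosure (Submodule.subset_span ⟨(a, b), ⟨ha, hb⟩, rfl⟩)
  -- a vector orthogonal to the increments over `I` is orthogonal to `E`
  have horth : ∀ v : L2, (∀ a ∈ I, ∀ b ∈ I, inner ℝ (ind b - ind a) v = 0) →
      ∀ u ∈ E, inner ℝ u v = 0 := by
    intro v hv u hu
    have : E₀ ≤ (Submodule.span ℝ {v})ᗮ := by
      refine Submodule.span_le.2 ?_
      rintro _ ⟨p, ⟨ha, hb⟩, rfl⟩
      exact (Submodule.mem_orthogonal_singleton_iff_inner_left).2 (hv _ ha _ hb)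
    exact (Submodule.mem_orthogonal_singleton_iff_inner_left).1
      (E₀.topologicalClosure_minimal this (Submodule.isClosed_orthogonal _) hu)
  set W : Submodule ℝ L2 := (K ⊔ Submodule.span ℝ {ind s, ind 1}).map
    (E.starProjection : L2 →ₗ[ℝ] L2) with hW
  have : FiniteDimensional ℝ (Submodule.span ℝ {ind s, ind 1}) :=
    FiniteDimensional.span_of_finite ℝ (by simp)
  have : FiniteDimensional ℝ W := by rw [hW]; infer_instance
  have hWE : W ≤ E := by
    rintro _ ⟨x, -, rfl⟩
    exact E.starProjection_apply_mem x
  have hnear : ∀ᶠ t in 𝓝[Set.Icc 0 1] s, |t - s| < δ / 2 := by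
    have : Continuous fun t : ℝ => |t - s| := by fun_prop
    have h0 : Tendsto (fun t : ℝ => |t - s|) (𝓝[Set.Icc 0 1] s) (𝓝 0) := by
      simpa using (this.tendsto s).mono_left nhdsWithin_le_nhds
    exact h0.eventually (gt_mem_nhds (half_pos hδ))
  filter_upwards [eventually_norm_starProjection_ind_sub_sq_le hs W, hnear, self_mem_nhdsWithin]
    with t ht1 ht2 ht
  have htI : t ∈ I := ⟨ht, ht2⟩
  set d := ind t - ind s with hd
  set ψ := d - W.starProjection d with hψ
  have hψE : ψ ∈ E := E.sub_mem (hE s hsI t htI) (hWE (W.starProjection_apply_mem d))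
  have hψW : ∀ w ∈ W, inner ℝ ψ w = 0 := fun w hw => Submodule.starProjection_inner_eq_zero _ _ hw
  have hψP : ∀ x ∈ K ⊔ Submodule.span ℝ {ind s, ind 1}, inner ℝ ψ x = 0 := by
    intro x hx
    rw [← Submodule.starProjection_eq_self_iff.2 hψE,
      Submodule.inner_starProjection_left_eq_right]
    exact hψW _ ⟨x, hx, rfl⟩
  have hψs : inner ℝ ψ (ind s) = 0 :=
    hψP _ (Submodule.mem_sup_right (Submodule.subset_span (by simp)))
  have hψ1 : inner ℝ ψ (ind 1) = 0 :=
    hψP _ (Submodule.mem_sup_right (Submodule.subset_span (by simp)))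
  have hψd : inner ℝ ψ d = ‖ψ‖ ^ 2 := by
    rw [← real_inner_self_eq_norm_sq]
    conv_rhs => rw [hψ, inner_sub_right, ← hψ, hψW _ (W.starProjection_apply_mem d), sub_zero]
  refine ⟨ψ, ⟨fun κ hκ => hψP κ (Submodule.mem_sup_left hκ), fun r hr hrt => ?_, ?_⟩, ?_⟩
  · have hrs : δ / 2 ≤ |r - s| := by
      have := abs_sub_le r s t
      rw [abs_sub_comm s t] at this
      linarith
    rcases le_total r s with h | h
    · rw [abs_of_nonpos (by linarith)] at hrs
      refine horth _ (fun a ha b hb => ?_) ψ hψE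
      have ha' := abs_lt.1 ha.2
      have hb' := abs_lt.1 hb.2
      rw [inner_sub_left, inner_ind hb.1 hr, inner_ind ha.1 hr, min_eq_right (by linarith),
        min_eq_right (by linarith), sub_self]
    · rw [abs_of_nonneg (by linarith)] at hrs
      have := horth (ind r - ind 1) (fun a ha b hb => ?_) ψ hψE
      · rwa [inner_sub_right, hψ1, sub_zero] at this
      have ha' := abs_lt.1 ha.2
      have hb' := abs_lt.1 hb.2
      rw [inner_sub_left, inner_sub_right, inner_sub_right, inner_ind hb.1 hr, inner_ind ha.1 hr,
        inner_ind hb.1 h1, inner_ind ha.1 h1, min_eq_left (by linarith), min_eq_left hb.1.2,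
        min_eq_left (by linarith), min_eq_left ha.1.2]
      ring
  · rw [← hψd, hd, inner_sub_right, hψs, sub_zero]
  · have e1 := norm_ind_sub_sq hs ht
    have e2 : ‖d‖ ^ 2 = ‖ψ‖ ^ 2 + ‖W.starProjection d‖ ^ 2 := by
      have : d = ψ + W.starProjection d := by rw [hψ]; abel
      conv_lhs => rw [this]
      rw [@norm_add_sq_real, hψW _ (W.starProjection_apply_mem d)]
      ring
    rw [← hd] at e1
    linarith

/-- By compactness of `[0;1]`, dual vectors exist everywhere, with `‖ψ‖²` bounded below by the
distance to a finite set. -/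
lemma exists_finset_forall_exists_isDual (K : Submodule ℝ L2) [FiniteDimensional ℝ K] {δ : ℝ}
    (hδ : 0 < δ) :
    ∃ S : Finset ℝ, S.Nonempty ∧ ∀ t ∈ Set.Icc (0 : ℝ) 1,
      ∃ ψ, IsDual K δ t ψ ∧ Metric.infDist t S ≤ 2 * ‖ψ‖ ^ 2 := by
  obtain ⟨S, -, hS⟩ := (isCompact_Icc (a := (0 : ℝ)) (b := 1)).elim_nhdsWithin_subcover
    (fun s => {t | ∃ ψ, IsDual K δ t ψ ∧ |t - s| ≤ 2 * ‖ψ‖ ^ 2})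
    fun s hs => eventually_exists_isDual K hδ hs
  refine ⟨S, ?_, fun t ht => ?_⟩
  · obtain ⟨s, hs, -⟩ := Set.mem_iUnion₂.1 (hS ⟨le_rfl, zero_le_one⟩)
    exact ⟨s, hs⟩
  · obtain ⟨s, hs, ψ, h1, h2⟩ := Set.mem_iUnion₂.1 (hS ht)
    exact ⟨ψ, h1, (Metric.infDist_le_dist_of_mem (Finset.mem_coe.2 hs)).trans h2⟩

/-! ### Lower bounds for Gram determinants -/

open Matrix in
lemma one_le_det_of_dotProduct_le {n : ℕ} {M : Matrix (Fin n) (Fin n) ℝ} (hM : M.IsHermitian)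
    (h : ∀ a, a ⬝ᵥ a ≤ a ⬝ᵥ M *ᵥ a) : 1 ≤ M.det := by
  rw [hM.det_eq_prod_eigenvalues]
  refine Finset.one_le_prod fun i _ => ?_
  change (1 : ℝ) ≤ hM.eigenvalues i
  rw [hM.eigenvalues_eq]
  refine le_trans ?_ (h _)
  have : ‖hM.eigenvectorBasis i‖ ^ 2 = 1 := by simp
  rw [← real_inner_self_eq_norm_sq] at this
  rw [← this]
  exact le_of_eq (by rw [PiLp.inner_apply]; simp [dotProduct, pow_two])

open Matrix in
/-- Monotonicity of the determinant: `NᵀN ≤ Γ` implies `det (NᵀN) ≤ det Γ`. -/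
lemma det_sq_le_det {n : ℕ} {Γ N : Matrix (Fin n) (Fin n) ℝ} (hΓ : Γ.PosSemidef)
    (h : ∀ a, (N *ᵥ a) ⬝ᵥ (N *ᵥ a) ≤ a ⬝ᵥ Γ *ᵥ a) : N.det ^ 2 ≤ Γ.det := by
  by_cases hN : N.det = 0
  · simpa [hN] using hΓ.det_nonneg
  have hu : IsUnit N.det := isUnit_iff_ne_zero.2 hN
  have h1 : 1 ≤ ((N⁻¹)ᵀ * Γ * N⁻¹).det := by
    refine one_le_det_of_dotProduct_le ?_ fun a => ?_
    · simpa using isHermitian_conjTranspose_mul_mul N⁻¹ hΓ.isHermitian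
    · have := h (N⁻¹ *ᵥ a)
      rw [mulVec_mulVec, mul_nonsing_inv _ hu, one_mulVec] at this
      refine this.trans (le_of_eq ?_)
      rw [← mulVec_mulVec, ← mulVec_mulVec, dotProduct_mulVec a, vecMul_transpose]
  rw [det_mul, det_mul, det_transpose, det_nonsing_inv, Ring.inverse_eq_inv'] at h1
  have h2 := mul_le_mul_of_nonneg_left h1 (sq_nonneg N.det)
  calc N.det ^ 2 = N.det ^ 2 * 1 := (mul_one _).symm
    _ ≤ _ := h2
    _ = Γ.det := by field_simp

lemma exists_pos_mul_norm_le (A : L2 →L[ℝ] L2) (hA : InvertibleOffKernel A) :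
    ∃ c : ℝ, 0 < c ∧ ∀ v ∈ (LinearMap.ker (A : L2 →ₗ[ℝ] L2))ᗮ, c * ‖v‖ ≤ ‖A v‖ := by
  obtain ⟨e, he⟩ := hA
  set C := ‖e.symm.toContinuousLinearMap‖
  refine ⟨(C + 1)⁻¹, by positivity, fun v hv => ?_⟩
  have h := e.symm.toContinuousLinearMap.le_opNorm (e ⟨v, hv⟩)
  simp only [ContinuousLinearEquiv.coe_coe, ContinuousLinearEquiv.symm_apply_apply] at h
  change ‖v‖ ≤ C * ‖(e ⟨v, hv⟩ : L2)‖ at h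
  rw [he] at h
  rw [inv_mul_le_iff₀ (by positivity)]
  have h2 := norm_nonneg (A v)
  change ‖v‖ ≤ C * ‖A v‖ at h
  linarith

/-- Testing `∑ b_j 𝟙_[0;t_j]` against dual vectors shows that each coefficient `b_i` is controlled
by the image under `A`, up to the square root of the distance from `t_i` to a fixed finite set. -/
lemma exists_finset_coeff_sq_le (A : L2 →L[ℝ] L2)
    (hA₁ : FiniteDimensional ℝ (LinearMap.ker (A : L2 →ₗ[ℝ] L2)))
    (hA₂ : InvertibleOffKernel A) {δ : ℝ} (hδ : 0 < δ) :
    ∃ S : Finset ℝ, S.Nonempty ∧ ∃ c : ℝ, 0 < c ∧ ∀ (m : ℕ) (t : Fin m → ℝ),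
      (∀ i, t i ∈ Set.Icc (0 : ℝ) 1) → (∀ i j, i ≠ j → δ ≤ |t i - t j|) →
      ∀ (b : Fin m → ℝ) (i : Fin m),
        c * Metric.infDist (t i) S * b i ^ 2 ≤ ‖A (∑ j, b j • ind (t j))‖ ^ 2 := by
  set K := LinearMap.ker (A : L2 →ₗ[ℝ] L2) with hK
  obtain ⟨S, hS, hdual⟩ := exists_finset_forall_exists_isDual K hδ
  obtain ⟨c, hc, hcA⟩ := exists_pos_mul_norm_le A hA₂
  refine ⟨S, hS, c ^ 2 / 2, by positivity, fun m t ht hsep b i => ?_⟩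
  obtain ⟨ψ, hψ, hρ⟩ := hdual (t i) (ht i)
  set u := ∑ j, b j • ind (t j) with hu
  have h1 : inner ℝ ψ u = b i * ‖ψ‖ ^ 2 := by
    rw [hu, inner_sum, Finset.sum_eq_single i, inner_smul_right, hψ.inner_ind_self]
    · intro j _ hj
      rw [inner_smul_right, hψ.inner_ind_of_le _ (ht j) (hsep j i hj), mul_zero]
    · simp
  have h2 : inner ℝ ψ (u - K.starProjection u) = b i * ‖ψ‖ ^ 2 := by
    rw [inner_sub_right, h1, hψ.inner_of_mem _ (K.starProjection_apply_mem u), sub_zero]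
  have h3 : A (u - K.starProjection u) = A u := by
    have : A (K.starProjection u) = 0 := K.starProjection_apply_mem u
    rw [map_sub, this, sub_zero]
  have h4 := hcA _ (K.sub_starProjection_mem_orthogonal u)
  rw [h3] at h4
  have h5 : |b i| * ‖ψ‖ ^ 2 ≤ ‖ψ‖ * ‖u - K.starProjection u‖ := by
    have := abs_real_inner_le_norm ψ (u - K.starProjection u)
    rwa [h2, abs_mul, abs_of_nonneg (sq_nonneg ‖ψ‖)] at this
  have h6 : |b i| * ‖ψ‖ ≤ ‖u - K.starProjection u‖ := by
    rcases (norm_nonneg ψ).eq_or_lt with h | h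
    · rw [← h, mul_zero]; exact norm_nonneg _
    · refine le_of_mul_le_mul_left ?_ h
      calc _ = |b i| * ‖ψ‖ ^ 2 := by ring
        _ ≤ _ := h5
  calc c ^ 2 / 2 * Metric.infDist (t i) S * b i ^ 2
      ≤ c ^ 2 / 2 * (2 * ‖ψ‖ ^ 2) * b i ^ 2 := by gcongr
    _ = (c * (|b i| * ‖ψ‖)) ^ 2 := by rw [mul_pow, mul_pow, sq_abs]; ring
    _ ≤ ‖A u‖ ^ 2 := by
        refine pow_le_pow_left₀ (by positivity) ?_ 2
        exact (mul_le_mul_of_nonneg_left h6 hc.le).trans h4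

/-- The matrix of the map taking the coefficients of a combination of increments
`y_{i+1} - y_i` to the coefficients of the same combination in terms of the `y_j`. -/
def incrMatrix (n : ℕ) : Matrix (Fin (n + 1)) (Fin n) ℝ :=
  Matrix.of fun j i => (if j = i.succ then 1 else 0) - (if j = i.castSucc then 1 else 0)

open Matrix in
lemma sum_incrMatrix_mulVec_smul {E : Type*} [AddCommGroup E] [Module ℝ E] {n : ℕ} (a : Fin n → ℝ)
    (y : Fin (n + 1) → E) :
    ∑ j, (incrMatrix n *ᵥ a) j • y j = ∑ i, a i • (y i.succ - y i.castSucc) := by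
  simp only [mulVec, dotProduct, Finset.sum_smul]
  rw [Finset.sum_comm]
  refine Finset.sum_congr rfl fun i _ => ?_
  simp only [incrMatrix, of_apply, sub_mul, sub_smul, ite_mul, one_mul, zero_mul, ite_smul,
    zero_smul, Finset.sum_sub_distrib, Finset.sum_ite_eq',
    Finset.mem_univ, if_true, smul_sub]

open Matrix in
/-- Any row may be dropped from `incrMatrix`, since its rows sum to zero. -/
lemma det_incrMatrix_submatrix_ne_zero {n : ℕ} (j : Fin (n + 1)) :
    ((incrMatrix n).submatrix j.succAbove id).det ≠ 0 := by
  intro h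
  obtain ⟨a, ha, h0⟩ := exists_mulVec_eq_zero_iff.2 h
  have hb : ∀ l, (incrMatrix n *ᵥ a) (j.succAbove l) = 0 := fun l => congrFun h0 l
  have hsum := sum_incrMatrix_mulVec_smul a (fun _ => (1 : ℝ))
  rw [Fin.sum_univ_succAbove _ j] at hsum
  simp only [hb, sub_self, smul_eq_mul, mul_zero, Finset.sum_const_zero, add_zero,
    mul_one] at hsum
  have hz : ∀ l, (incrMatrix n *ᵥ a) l = 0 := by
    intro l
    rcases eq_or_ne l j with rfl | hl
    · exact hsum
    · obtain ⟨l', rfl⟩ := Fin.exists_succAbove_eq hl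
      exact hb l'
  refine ha (funext fun i => ?_)
  -- test against the step function that jumps between `i` and `i + 1`
  have h1 := sum_incrMatrix_mulVec_smul a (fun l => if i.castSucc < l then (1 : ℝ) else 0)
  simp only [hz, zero_smul, Finset.sum_const_zero] at h1
  rw [Finset.sum_eq_single i] at h1
  · simpa using h1.symm
  · intro l _ hl
    have : (i.castSucc < l.succ) ↔ i.castSucc < l.castSucc := by
      simp only [Fin.lt_def, Fin.val_castSucc, Fin.val_succ]
      have := fun h => hl (Fin.ext h)
      omega
    simp [this]
  · simp

open Matrix in
/-- The Gram determinant is bounded below by the product of the distances to a finite set, any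
one of the `n + 1` points being left out. -/
lemma exists_finset_prod_succAbove_le_gramDet (A : L2 →L[ℝ] L2)
    (hA₁ : FiniteDimensional ℝ (LinearMap.ker (A : L2 →ₗ[ℝ] L2)))
    (hA₂ : InvertibleOffKernel A) {δ : ℝ} (hδ : 0 < δ) (n : ℕ) :
    ∃ S : Finset ℝ, S.Nonempty ∧ ∀ j : Fin (n + 1), ∃ c : ℝ, 0 < c ∧
      ∀ t ∈ offDiag (n + 1) δ,
        c * ∏ l : Fin n, Metric.infDist (t (j.succAbove l)) S ≤ gramDet A t := by
  obtain ⟨S, hS, c, hc, hcoeff⟩ := exists_finset_coeff_sq_le A hA₁ hA₂ hδ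
  refine ⟨S, hS, fun j => ?_⟩
  set B := (incrMatrix n).submatrix j.succAbove id with hB
  have hdet : B.det ≠ 0 := det_incrMatrix_submatrix_ne_zero j
  refine ⟨(c / (n + 1)) ^ n * B.det ^ 2, by positivity, fun t ht => ?_⟩
  obtain ⟨⟨ht01, hmono⟩, hgap⟩ := ht
  have hstep : ∀ i j : Fin (n + 1), i < j → δ ≤ t j - t i := by
    intro i j hij
    obtain ⟨l, rfl⟩ := Fin.exists_castSucc_eq.2 (Fin.ne_last_of_lt hij)
    have h1 : δ ≤ t l.succ - t l.castSucc := hgap l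
    have h2 := hmono (Fin.castSucc_lt_iff_succ_le.1 hij)
    linarith
  have hsep : ∀ i j, i ≠ j → δ ≤ |t i - t j| := by
    intro i j hij
    rcases lt_or_gt_of_ne hij with h | h
    · rw [abs_sub_comm]; exact (hstep i j h).trans (le_abs_self _)
    · exact (hstep j i h).trans (le_abs_self _)
  set ρ : Fin (n + 1) → ℝ := fun i => Metric.infDist (t i) S
  have hρ : ∀ i, 0 ≤ ρ i := fun i => Metric.infDist_nonneg
  set N : Matrix (Fin n) (Fin n) ℝ :=
    Matrix.diagonal (fun l => √(c / (n + 1) * ρ (j.succAbove l))) * B with hN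
  have hle : N.det ^ 2 ≤ gramDet A t := by
    refine det_sq_le_det (posSemidef_gram ℝ _) fun a => ?_
    set b := incrMatrix n *ᵥ a with hb
    have e1 : a ⬝ᵥ gram ℝ (incr A t) *ᵥ a = ‖A (∑ j, b j • ind (t j))‖ ^ 2 := by
      have := star_dotProduct_gram_mulVec (𝕜 := ℝ) (incr A t) a a
      rw [star_trivial] at this
      rw [this, real_inner_self_eq_norm_sq, hb, sum_incrMatrix_mulVec_smul]
      simp only [map_sum, map_smul, map_sub]
      rfl
    have e2 : ∀ l, (N *ᵥ a) l = √(c / (n + 1) * ρ (j.succAbove l)) * b (j.succAbove l) := by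
      intro l
      rw [hN, ← mulVec_mulVec, mulVec_diagonal]
      rfl
    have e3 : ∀ l, (N *ᵥ a) l * (N *ᵥ a) l ≤ ‖A (∑ j, b j • ind (t j))‖ ^ 2 / (n + 1) := by
      intro l
      have := hcoeff (n + 1) t ht01 hsep b (j.succAbove l)
      have h0 : 0 ≤ c / (n + 1) * ρ (j.succAbove l) := mul_nonneg (by positivity) (hρ _)
      rw [e2, mul_mul_mul_comm, Real.mul_self_sqrt h0, le_div_iff₀ (by positivity)]
      refine le_trans (le_of_eq ?_) this
      change _ = c * ρ (j.succAbove l) * _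
      field_simp
    rw [e1]
    calc (N *ᵥ a) ⬝ᵥ (N *ᵥ a) ≤ ∑ _l : Fin n, ‖A (∑ j, b j • ind (t j))‖ ^ 2 / (n + 1) :=
          Finset.sum_le_sum fun l _ => e3 l
      _ = n / (n + 1) * ‖A (∑ j, b j • ind (t j))‖ ^ 2 := by
          rw [Finset.sum_const, Finset.card_univ, Fintype.card_fin, nsmul_eq_mul]; ring
      _ ≤ _ := mul_le_of_le_one_left (sq_nonneg _)
          ((div_le_one (by positivity)).2 (by linarith))
  refine le_trans (le_of_eq ?_) hle
  have h0 : ∀ l, 0 ≤ c / (n + 1) * ρ (j.succAbove l) := fun l => mul_nonneg (by positivity) (hρ _)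
  rw [hN, det_mul, det_diagonal, mul_pow, ← Finset.prod_pow]
  simp only [Real.sq_sqrt (h0 _)]
  rw [Finset.prod_mul_distrib, Finset.prod_const, Finset.card_univ, Fintype.card_fin]
  ring

/-- Multiplying the bounds over the omitted point gives a symmetric one. The exponent
`n / (n + 1)` of the distances is less than `1`, so that the bound for `1 / G` is integrable. -/
lemma exists_finset_inv_gramDet_le (A : L2 →L[ℝ] L2)
    (hA₁ : FiniteDimensional ℝ (LinearMap.ker (A : L2 →ₗ[ℝ] L2)))
    (hA₂ : InvertibleOffKernel A) {δ : ℝ} (hδ : 0 < δ) (n : ℕ) :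
    ∃ S : Finset ℝ, S.Nonempty ∧ ∃ C : ℝ, ∀ t ∈ offDiag (n + 1) δ, (∀ i, t i ∉ S) →
      0 < gramDet A t ∧
      (gramDet A t)⁻¹ ≤ C * ∏ i, Metric.infDist (t i) S ^ (-(n / (n + 1) : ℝ)) := by
  obtain ⟨S, hS, h⟩ := exists_finset_prod_succAbove_le_gramDet A hA₁ hA₂ hδ n
  choose c hc hle using h
  have hD : 0 < ∏ j, c j := Finset.prod_pos fun j _ => hc j
  refine ⟨S, hS, (∏ j, c j) ^ (-(1 / (n + 1) : ℝ)), fun t ht htS => ?_⟩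
  set ρ : Fin (n + 1) → ℝ := fun i => Metric.infDist (t i) S
  have hρ : ∀ i, 0 < ρ i := fun i =>
    (S.finite_toSet.isClosed.notMem_iff_infDist_pos hS).1 (htS i)
  set G := gramDet A t
  have hG : 0 < G := lt_of_lt_of_le
    (mul_pos (hc 0) (Finset.prod_pos fun l _ => hρ ((0 : Fin (n + 1)).succAbove l))) (hle 0 t ht)
  refine ⟨hG, ?_⟩
  set P := ∏ i, ρ i
  have hP : 0 < P := Finset.prod_pos fun i _ => hρ i
  have e1 : ∀ j, ∏ l : Fin n, ρ (j.succAbove l) = P / ρ j := by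
    intro j
    rw [eq_div_iff (hρ j).ne', mul_comm]
    exact (Fin.prod_univ_succAbove ρ j).symm
  have e2 : (∏ j, c j) * P ^ n ≤ G ^ (n + 1) := by
    calc (∏ j, c j) * P ^ n = ∏ j, (c j * ∏ l : Fin n, ρ (j.succAbove l)) := by
          simp only [e1]
          rw [Finset.prod_mul_distrib, Finset.prod_div_distrib, Finset.prod_const,
            Finset.card_univ, Fintype.card_fin]
          congr 1
          change P ^ n = P ^ (n + 1) / P
          rw [pow_succ, mul_div_cancel_right₀ _ hP.ne']
      _ ≤ ∏ _j : Fin (n + 1), G := Finset.prod_le_prod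
          (fun j _ => mul_nonneg (hc j).le (Finset.prod_nonneg fun l _ => (hρ _).le))
          fun j _ => hle j t ht
      _ = G ^ (n + 1) := by simp
  have hn : (0 : ℝ) < n + 1 := by positivity
  have e3 : G⁻¹ = (G ^ (n + 1)) ^ (-(1 / (n + 1) : ℝ)) := by
    rw [← Real.rpow_natCast, ← Real.rpow_mul hG.le, ← Real.rpow_neg_one]
    congr 1
    push_cast
    field_simp
  rw [e3]
  calc (G ^ (n + 1)) ^ (-(1 / (n + 1) : ℝ))
      ≤ ((∏ j, c j) * P ^ n) ^ (-(1 / (n + 1) : ℝ)) :=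
        Real.rpow_le_rpow_of_nonpos (by positivity) e2 (by
          rw [neg_nonpos]; positivity)
    _ = _ := by
        rw [Real.mul_rpow hD.le (by positivity), ← Real.rpow_natCast, ← Real.rpow_mul hP.le]
        congr 1
        rw [Real.finsetProd_rpow _ _ fun i _ => (hρ i).le]
        congr 1
        field_simp

/-! ### Integrability of the bound -/

lemma integrableOn_abs_rpow {r : ℝ} (hr : -1 < r) (a b : ℝ) :
    IntegrableOn (fun x : ℝ => |x| ^ r) (Set.Icc a b) := by
  have h1 : ∀ M : ℝ, 0 ≤ M → IntegrableOn (fun x : ℝ => |x| ^ r) (Set.Icc 0 M) := by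
    intro M hM
    have h := (intervalIntegrable_iff_integrableOn_Icc_of_le hM).1
      (intervalIntegral.intervalIntegrable_rpow' (a := 0) (b := M) hr)
    exact h.congr_fun (fun x hx => by simp only [abs_of_nonneg hx.1]) measurableSet_Icc
  set M := max |a| |b|
  have hM : 0 ≤ M := (abs_nonneg a).trans (le_max_left _ _)
  have h2 : IntegrableOn (fun x : ℝ => |x| ^ r) (Set.Icc (-M) 0) := by
    have := (h1 M hM)
    rw [← integrable_indicator_iff measurableSet_Icc] at this ⊢
    refine this.comp_neg.congr (Eventually.of_forall fun x => ?_)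
    simp only [Set.indicator, Set.mem_Icc, abs_neg]
    refine if_congr ⟨fun h => ⟨by linarith [h.2], by linarith [h.1]⟩,
      fun h => ⟨by linarith [h.2], by linarith [h.1]⟩⟩ rfl rfl
  refine (h2.union (h1 M hM)).mono_set fun x hx => ?_
  have ha : -M ≤ a := by linarith [neg_abs_le a, le_max_left |a| |b|]
  have hb : b ≤ M := (le_abs_self b).trans (le_max_right _ _)
  rcases le_total x 0 with h | h
  · exact Or.inl ⟨ha.trans hx.1, h⟩
  · exact Or.inr ⟨h, hx.2.trans hb⟩

lemma integrableOn_infDist_rpow {S : Finset ℝ} (hS : S.Nonempty) {r : ℝ} (hr : -1 < r) :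
    IntegrableOn (fun x : ℝ => Metric.infDist x S ^ r) (Set.Icc 0 1) := by
  have h1 : ∀ s : ℝ, IntegrableOn (fun x : ℝ => |x - s| ^ r) (Set.Icc 0 1) := by
    intro s
    have := integrableOn_abs_rpow hr (0 - s) (1 - s)
    rw [← integrable_indicator_iff measurableSet_Icc] at this ⊢
    refine (this.comp_sub_right s).congr (Eventually.of_forall fun x => ?_)
    simp only [Set.indicator, Set.mem_Icc, sub_le_sub_iff_right]
  have h2 : IntegrableOn (fun x : ℝ => ∑ s ∈ S, |x - s| ^ r) (Set.Icc 0 1) :=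
    integrable_finsetSum S fun s _ => h1 s
  refine h2.mono' ?_ (Eventually.of_forall fun x => ?_)
  · exact ((Metric.continuous_infDist_pt _).measurable.pow_const r).aestronglyMeasurable
  · obtain ⟨s, hs, hd⟩ := S.finite_toSet.isCompact.exists_infDist_eq_dist hS x
    rw [Real.norm_of_nonneg (Real.rpow_nonneg Metric.infDist_nonneg _), hd, Real.dist_eq]
    exact Finset.single_le_sum (f := fun s => |x - s| ^ r)
      (fun s _ => Real.rpow_nonneg (abs_nonneg _) _) hs

lemma measurableSet_offDiag (k : ℕ) (δ : ℝ) : MeasurableSet (offDiag k δ) := by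
  have : IsClosed (offDiag k δ) := by
    have h : offDiag k δ = (⋂ i, {t | t i ∈ Set.Icc (0 : ℝ) 1}) ∩
        (⋂ i, ⋂ j, ⋂ (_ : i ≤ j), {t | t i ≤ t j}) ∩
        ⋂ i : Fin (k - 1), {t | δ ≤ t (hi i) - t (lo i)} := by
      ext t
      simp [offDiag, simplex, Monotone]
    rw [h]
    refine ((isClosed_iInter fun i => ?_).inter (isClosed_iInter fun i => isClosed_iInter fun j =>
      isClosed_iInter fun _ => ?_)).inter (isClosed_iInter fun i => ?_)
    · exact isClosed_Icc.preimage (continuous_apply i)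
    · exact isClosed_le (continuous_apply i) (continuous_apply j)
    · exact isClosed_le continuous_const ((continuous_apply _).sub (continuous_apply _))
  exact this.measurableSet

lemma offDiag_subset_pi (k : ℕ) (δ : ℝ) :
    offDiag k δ ⊆ Set.univ.pi fun _ => Set.Icc (0 : ℝ) 1 := fun _ ht i _ => ht.1.1 i

lemma volume_offDiag_lt_top (k : ℕ) (δ : ℝ) : volume (offDiag k δ) < ⊤ := by
  refine (measure_mono (offDiag_subset_pi k δ)).trans_lt ?_
  rw [volume_pi_pi]
  simp

lemma integrableOn_prod_offDiag {k : ℕ} {δ : ℝ} {f : ℝ → ℝ} (hf : IntegrableOn f (Set.Icc 0 1)) :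
    IntegrableOn (fun t : Fin k → ℝ => ∏ i, f (t i)) (offDiag k δ) := by
  refine IntegrableOn.mono_set ?_ (offDiag_subset_pi k δ)
  rw [IntegrableOn, volume_pi, Measure.restrict_pi_pi]
  exact Integrable.fintype_prod fun _ => hf

/-- Off the diagonals the Gram determinant is almost everywhere positive, and its inverse has an
integrable bound. -/
lemma exists_integrableOn_inv_gramDet_le (A : L2 →L[ℝ] L2)
    (hA₁ : FiniteDimensional ℝ (LinearMap.ker (A : L2 →ₗ[ℝ] L2)))
    (hA₂ : InvertibleOffKernel A) {δ : ℝ} (hδ : 0 < δ) (n : ℕ) :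
    ∃ H : (Fin (n + 1) → ℝ) → ℝ, IntegrableOn H (offDiag (n + 1) δ) ∧
      ∀ᵐ t ∂(volume.restrict (offDiag (n + 1) δ)),
        0 < gramDet A t ∧ (gramDet A t)⁻¹ ≤ H t := by
  obtain ⟨S, hS, C, h⟩ := exists_finset_inv_gramDet_le A hA₁ hA₂ hδ n
  have hr : (-1 : ℝ) < -(n / (n + 1) : ℝ) := by
    rw [neg_lt_neg_iff, div_lt_one (by positivity)]; linarith
  refine ⟨_, (integrableOn_prod_offDiag (integrableOn_infDist_rpow hS hr)).const_mul C, ?_⟩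
  have hnull : ∀ᵐ t : Fin (n + 1) → ℝ, ∀ i, t i ∉ S := by
    rw [eventually_all]
    intro i
    have : ∀ᵐ x : ℝ, x ∉ S := by
      have := S.finite_toSet.measure_zero (volume : Measure ℝ)
      exact measure_eq_zero_iff_ae_notMem.1 this
    exact (Measure.quasiMeasurePreserving_eval (μ := fun _ => (volume : Measure ℝ)) i).ae this
  filter_upwards [ae_restrict_of_ae hnull, ae_restrict_mem (measurableSet_offDiag _ _)]
    with t h1 h2
  exact h t h2 h1

/-! ### Gaussian integrals against narrow kernels -/

/-- The Gaussian density with mean `0` and variance `ε` on the line; the planar kernel `heat ε` is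
the product of two copies of it. -/
def lineHeat (ε x : ℝ) : ℝ := (√(2 * Real.pi * ε))⁻¹ * Real.exp (-x ^ 2 / (2 * ε))

lemma lineHeat_nonneg (ε x : ℝ) : 0 ≤ lineHeat ε x := by unfold lineHeat; positivity

lemma lineHeat_le {ε : ℝ} (hε : 0 < ε) (x : ℝ) : lineHeat ε x ≤ (√(2 * Real.pi * ε))⁻¹ := by
  refine mul_le_of_le_one_right (by positivity) (Real.exp_le_one_iff.2 ?_)
  exact div_nonpos_of_nonpos_of_nonneg (by nlinarith [sq_nonneg x]) (by positivity)

@[fun_prop]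
lemma continuous_lineHeat (ε : ℝ) : Continuous (lineHeat ε) := by unfold lineHeat; fun_prop

lemma heat_eq_mul {ε : ℝ} (hε : 0 < ε) (z : Plane) :
    heat ε z = lineHeat ε (z 0) * lineHeat ε (z 1) := by
  unfold heat lineHeat
  have h1 : (√(2 * Real.pi * ε))⁻¹ * (√(2 * Real.pi * ε))⁻¹ = 1 / (2 * Real.pi * ε) := by
    rw [← mul_inv, Real.mul_self_sqrt (by positivity), one_div]
  rw [mul_mul_mul_comm, h1, ← Real.exp_add, EuclideanSpace.norm_sq_eq, Fin.sum_univ_two,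
    Real.norm_eq_abs, Real.norm_eq_abs, sq_abs, sq_abs]
  congr 2
  ring

lemma lineHeat_one (x : ℝ) : lineHeat 1 x = gaussianPDFReal 0 1 x := by
  simp [lineHeat, gaussianPDFReal]

lemma lineHeat_mul_sqrt {ε : ℝ} (hε : 0 < ε) (x : ℝ) :
    lineHeat ε x = (√ε)⁻¹ * lineHeat 1 ((√ε)⁻¹ * x) := by
  unfold lineHeat
  rw [Real.sqrt_mul (by positivity) ε, mul_pow, inv_pow, Real.sq_sqrt hε.le, mul_one, mul_inv]
  rw [show -x ^ 2 / (2 * ε) = -(ε⁻¹ * x ^ 2) / (2 * 1) by field_simp]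
  ring

lemma integral_prod_lineHeat_one (n : ℕ) : ∫ y : Fin n → ℝ, ∏ i, lineHeat 1 (y i) = 1 := by
  rw [integral_fintype_prod_volume_eq_prod (fun (_ : Fin n) x => lineHeat 1 x)]
  simp [lineHeat_one, integral_gaussianPDFReal_eq_one]

lemma integrable_prod_lineHeat_one (n : ℕ) :
    Integrable fun y : Fin n → ℝ => ∏ i, lineHeat 1 (y i) := by
  refine Integrable.fintype_prod (f := fun _ => lineHeat 1) fun _ => ?_
  exact (integrable_gaussianPDFReal 0 1).congr
    (Eventually.of_forall fun x => (lineHeat_one x).symm)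

lemma pi_gaussianReal_eq_withDensity (n : ℕ) :
    Measure.pi (fun _ : Fin n => gaussianReal 0 1)
      = (volume : Measure (Fin n → ℝ)).withDensity
        fun z => ENNReal.ofReal (∏ i, lineHeat 1 (z i)) := by
  refine Measure.pi_eq fun s hs => ?_
  have hint : ∀ i, Integrable (lineHeat 1) (volume.restrict (s i)) := fun i =>
    ((integrable_gaussianPDFReal 0 1).congr
      (Eventually.of_forall fun x => (lineHeat_one x).symm)).restrict
  rw [withDensity_apply _ (MeasurableSet.univ_pi hs), volume_pi, Measure.restrict_pi_pi,
    ← ofReal_integral_eq_lintegral_ofReal (Integrable.fintype_prod hint)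
      (Eventually.of_forall fun z => Finset.prod_nonneg fun i _ => lineHeat_nonneg _ _),
    integral_fintype_prod_eq_prod (fun _ => lineHeat 1),
    ENNReal.ofReal_prod_of_nonneg fun i _ => integral_nonneg fun x => lineHeat_nonneg _ _]
  refine Finset.prod_congr rfl fun i _ => ?_
  rw [gaussianReal_apply_eq_integral 0 one_ne_zero]
  simp only [lineHeat_one]

open Matrix in
/-- The rescaling `z = √ε M⁻¹ y` in a Gaussian integral against a product of narrow kernels. -/
lemma integral_prod_lineHeat_mulVec {n : ℕ} (M : Matrix (Fin n) (Fin n) ℝ) (hM : M.det ≠ 0)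
    (a : Fin n → ℝ) {ε : ℝ} (hε : 0 < ε) :
    ∫ z : Fin n → ℝ, (∏ i, lineHeat ε ((M *ᵥ z) i)) * ∏ l, lineHeat 1 (z l - a l)
      = |M.det|⁻¹ * ∫ y : Fin n → ℝ, (∏ i, lineHeat 1 (y i)) *
          ∏ l, lineHeat 1 (√ε * (M⁻¹ *ᵥ y) l - a l) := by
  have hs : 0 < √ε := Real.sqrt_pos.2 hε
  set N : Matrix (Fin n) (Fin n) ℝ := (√ε)⁻¹ • M with hN
  have hNdet : N.det = (√ε)⁻¹ ^ n * M.det := by rw [hN, det_smul, Fintype.card_fin]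
  have hN0 : N.det ≠ 0 := by rw [hNdet]; positivity
  set F : (Fin n → ℝ) → ℝ := fun y => (∏ i, lineHeat 1 (y i)) *
          ∏ l, lineHeat 1 (√ε * (M⁻¹ *ᵥ y) l - a l) with hF
  have hFc : Continuous F := by
    have : Continuous fun y : Fin n → ℝ => M⁻¹ *ᵥ y := Continuous.matrix_mulVec continuous_const
      continuous_id
    have h2 : ∀ l, Continuous fun y : Fin n → ℝ => (M⁻¹ *ᵥ y) l := fun l =>
      (continuous_apply l).comp this
    have := fun l => h2 l
    fun_prop
  have hmap := Real.map_matrix_volume_pi_eq_smul_volume_pi hN0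
  have hNc : Continuous (toLin' N) := LinearMap.continuous_of_finiteDimensional _
  have e1 : ∫ z : Fin n → ℝ, F (toLin' N z) = |N.det|⁻¹ * ∫ y, F y := by
    rw [← integral_map hNc.aemeasurable hFc.aestronglyMeasurable, hmap, integral_smul_measure,
      ENNReal.toReal_ofReal (abs_nonneg _), abs_inv, smul_eq_mul]
  have e2 : ∀ z : Fin n → ℝ, (∏ i, lineHeat ε ((M *ᵥ z) i)) * ∏ l, lineHeat 1 (z l - a l)
      = (√ε)⁻¹ ^ n * F (toLin' N z) := by
    intro z
    have h1 : ∀ l, √ε * (M⁻¹ *ᵥ (N *ᵥ z)) l = z l := by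
      intro l
      rw [hN, smul_mulVec, mulVec_smul, mulVec_mulVec, nonsing_inv_mul _ (isUnit_iff_ne_zero.2 hM),
        one_mulVec, Pi.smul_apply, smul_eq_mul, mul_inv_cancel_left₀ hs.ne']
    simp only [hF, toLin'_apply, h1]
    simp only [hN, smul_mulVec, Pi.smul_apply, smul_eq_mul, lineHeat_mul_sqrt hε]
    rw [Finset.prod_mul_distrib, Finset.prod_const, Finset.card_univ, Fintype.card_fin]
    simp only [mul_assoc]
  simp only [e2]
  rw [integral_const_mul, e1, hNdet, abs_mul, abs_of_pos (by positivity), mul_inv]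
  field_simp

open Matrix in
lemma integral_prod_lineHeat_mulVec_le {n : ℕ} (M : Matrix (Fin n) (Fin n) ℝ) (hM : M.det ≠ 0)
    (a : Fin n → ℝ) {ε : ℝ} (hε : 0 < ε) :
    ∫ z : Fin n → ℝ, (∏ i, lineHeat ε ((M *ᵥ z) i)) * ∏ l, lineHeat 1 (z l - a l)
      ≤ |M.det|⁻¹ * (√(2 * Real.pi))⁻¹ ^ n := by
  rw [integral_prod_lineHeat_mulVec M hM a hε]
  refine mul_le_mul_of_nonneg_left ?_ (by positivity)
  have h0 : ∀ y : Fin n → ℝ, 0 ≤ ∏ i, lineHeat 1 (y i) := fun y =>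
    Finset.prod_nonneg fun i _ => lineHeat_nonneg _ _
  calc _ ≤ ∫ y : Fin n → ℝ, (∏ i, lineHeat 1 (y i)) * (√(2 * Real.pi))⁻¹ ^ n := by
        refine integral_mono_of_nonneg (Eventually.of_forall fun y => mul_nonneg (h0 y)
          (Finset.prod_nonneg fun i _ => lineHeat_nonneg _ _))
          ((integrable_prod_lineHeat_one n).mul_const _) (Eventually.of_forall fun y => ?_)
        refine mul_le_mul_of_nonneg_left ?_ (h0 y)
        refine (Finset.prod_le_prod (fun i _ => lineHeat_nonneg _ _)
          fun i _ => lineHeat_le one_pos _).trans (le_of_eq ?_)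
        simp
    _ = _ := by rw [integral_mul_const, integral_prod_lineHeat_one, one_mul]

open Matrix in
lemma tendsto_integral_prod_lineHeat_mulVec {n : ℕ} (M : Matrix (Fin n) (Fin n) ℝ)
    (hM : M.det ≠ 0) (a : Fin n → ℝ) :
    Tendsto (fun ε => ∫ z : Fin n → ℝ,
        (∏ i, lineHeat ε ((M *ᵥ z) i)) * ∏ l, lineHeat 1 (z l - a l)) (𝓝[>] 0)
      (𝓝 (|M.det|⁻¹ * ((√(2 * Real.pi))⁻¹ ^ n * Real.exp (-(1 / 2) * ∑ l, a l ^ 2)))) := by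
  have hlim : (√(2 * Real.pi))⁻¹ ^ n * Real.exp (-(1 / 2) * ∑ l, a l ^ 2)
      = ∫ y : Fin n → ℝ, (∏ i, lineHeat 1 (y i)) * ∏ l, lineHeat 1 (0 - a l) := by
    rw [integral_mul_const, integral_prod_lineHeat_one, one_mul]
    unfold lineHeat
    rw [Finset.prod_mul_distrib, ← Real.exp_sum, Finset.prod_const, Finset.card_univ,
      Fintype.card_fin, mul_one, Finset.mul_sum]
    congr 2
    exact Finset.sum_congr rfl fun l _ => by ring
  have hc : ∀ l, Continuous fun y : Fin n → ℝ => (M⁻¹ *ᵥ y) l := fun l =>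
    (continuous_apply l).comp (Continuous.matrix_mulVec continuous_const continuous_id)
  have key : Tendsto (fun ε => ∫ y : Fin n → ℝ, (∏ i, lineHeat 1 (y i)) *
      ∏ l, lineHeat 1 (√ε * (M⁻¹ *ᵥ y) l - a l)) (𝓝[>] 0)
      (𝓝 (∫ y : Fin n → ℝ, (∏ i, lineHeat 1 (y i)) * ∏ l, lineHeat 1 (0 - a l))) := by
    refine tendsto_integral_filter_of_dominated_convergence
      (fun y => (∏ i, lineHeat 1 (y i)) * (√(2 * Real.pi * 1))⁻¹ ^ n) ?_ ?_
      ((integrable_prod_lineHeat_one n).mul_const _) ?_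
    · refine Eventually.of_forall fun ε => Continuous.aestronglyMeasurable ?_
      have := hc
      fun_prop
    · refine Eventually.of_forall fun ε => Eventually.of_forall fun y => ?_
      have h0 : 0 ≤ ∏ i, lineHeat 1 (y i) := Finset.prod_nonneg fun i _ => lineHeat_nonneg _ _
      rw [Real.norm_of_nonneg (mul_nonneg h0 (Finset.prod_nonneg fun i _ => lineHeat_nonneg _ _))]
      refine mul_le_mul_of_nonneg_left ?_ h0
      refine (Finset.prod_le_prod (fun i _ => lineHeat_nonneg _ _)
        fun i _ => lineHeat_le one_pos _).trans (le_of_eq ?_)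
      simp
    · refine Eventually.of_forall fun y => ?_
      have hcε : Continuous fun ε : ℝ => (∏ i, lineHeat 1 (y i)) *
          ∏ l, lineHeat 1 (√ε * (M⁻¹ *ᵥ y) l - a l) := by fun_prop
      simpa using (hcε.tendsto 0).mono_left nhdsWithin_le_nhds
  rw [hlim]
  refine (key.const_mul _).congr' ?_
  filter_upwards [self_mem_nhdsWithin] with ε hε
  exact (integral_prod_lineHeat_mulVec M hM a hε).symm

/-! ### White noise -/

section WhiteNoise

variable {Ω : Type*} [MeasurableSpace Ω] {μ : Measure Ω} {ξ : L2 → Ω → ℝ}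

lemma IsWhiteNoise.memLp_two (hξ : IsWhiteNoise μ ξ) (h : L2) : MemLp (ξ h) 2 μ :=
  (hξ.gaussian.hasGaussianLaw_eval h).memLp_two

/-- A white noise is almost surely linear, since `h ↦ ξ h` preserves inner products. -/
lemma IsWhiteNoise.ae_sum_smul (hξ : IsWhiteNoise μ ξ) {ι : Type*} [Fintype ι] (a : ι → ℝ)
    (e : ι → L2) : ∀ᵐ ω ∂μ, ξ (∑ i, a i • e i) ω = ∑ i, a i * ξ (e i) ω := by
  set φ : L2 → Lp ℝ 2 μ := fun h => (hξ.memLp_two h).toLp (ξ h) with hφ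
  have hinner : ∀ h h', inner ℝ (φ h) (φ h') = inner ℝ h h' := by
    intro h h'
    rw [← hξ.covariance h h', L2.inner_def]
    refine integral_congr_ae ?_
    filter_upwards [(hξ.memLp_two h).coeFn_toLp, (hξ.memLp_two h').coeFn_toLp] with ω h1 h2
    simp only [hφ, h1, h2]
    simp [mul_comm]
  set x := ∑ i, a i • e i with hx
  have horth : ∀ y, inner ℝ (φ x - ∑ i, a i • φ (e i)) (φ y) = 0 := by
    intro y
    rw [inner_sub_left, sum_inner, hinner, hx, sum_inner]
    simp only [real_inner_smul_left, hinner, sub_self]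
  have hzero : φ x - ∑ i, a i • φ (e i) = 0 := by
    rw [← inner_self_eq_zero (𝕜 := ℝ), inner_sub_right, horth, inner_sum]
    simp only [real_inner_smul_right, horth, mul_zero, Finset.sum_const_zero, sub_zero]
  have h1 := sub_eq_zero.1 hzero
  have h2 : ⇑(∑ i, a i • φ (e i)) =ᵐ[μ] fun ω => ∑ i, a i * φ (e i) ω := by
    have hs := Lp.coeFn_finsetSum Finset.univ (fun i => a i • φ (e i))
    have hsm : ∀ᵐ ω ∂μ, ∀ i, (a i • φ (e i) : Lp ℝ 2 μ) ω = a i * φ (e i) ω :=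
      eventually_all.2 fun i => by
        filter_upwards [Lp.coeFn_smul (a i) (φ (e i))] with ω hω
        rw [hω]; rfl
    filter_upwards [hs, hsm] with ω h3 h4
    rw [h3, Finset.sum_apply]
    exact Finset.sum_congr rfl fun i _ => h4 i
  have h3 : ∀ᵐ ω ∂μ, ∀ i, φ (e i) ω = ξ (e i) ω :=
    eventually_all.2 fun i => (hξ.memLp_two (e i)).coeFn_toLp
  filter_upwards [h2, h3, (hξ.memLp_two x).coeFn_toLp] with ω h4 h5 h6
  rw [← h6]
  change (φ x : Ω → ℝ) ω = _
  rw [h1, h4]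
  simp only [h5]

lemma IsWhiteNoise.ae_sub (hξ : IsWhiteNoise μ ξ) (f g : L2) :
    ∀ᵐ ω ∂μ, ξ (f - g) ω = ξ f ω - ξ g ω := by
  filter_upwards [hξ.ae_sum_smul ![1, -1] ![f, g]] with ω h
  simpa [Fin.sum_univ_two, sub_eq_add_neg] using h

variable [IsProbabilityMeasure μ]

lemma IsWhiteNoise.covariance_eq_inner (hξ : IsWhiteNoise μ ξ) (f g : L2) :
    cov[ξ f, ξ g; μ] = inner ℝ f g := by
  rw [covariance_eq_sub (hξ.memLp_two f) (hξ.memLp_two g), hξ.mean_zero, zero_mul, sub_zero,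
    ← hξ.covariance]
  rfl

lemma IsWhiteNoise.map_eq_gaussianReal (hξ : IsWhiteNoise μ ξ) (h : L2) :
    μ.map (ξ h) = gaussianReal 0 (‖h‖ ^ 2).toNNReal := by
  rw [(hξ.gaussian.hasGaussianLaw_eval h).map_eq_gaussianReal, hξ.mean_zero,
    ← covariance_self (hξ.measurable h).aemeasurable, hξ.covariance_eq_inner,
    real_inner_self_eq_norm_sq]

lemma IsWhiteNoise.integral_exp_sub (hξ : IsWhiteNoise μ ξ) (h : L2) :
    ∫ ω, Real.exp (ξ h ω - 1 / 2 * ‖h‖ ^ 2) ∂μ = 1 := by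
  have h1 := mgf_gaussianReal (hξ.map_eq_gaussianReal h) 1
  simp only [mgf, one_mul, zero_add, one_pow, mul_one,
    Real.coe_toNNReal _ (sq_nonneg ‖h‖)] at h1
  simp only [Real.exp_sub]
  rw [integral_div, h1, div_eq_one_iff_eq (Real.exp_ne_zero _)]
  congr 1
  ring

lemma IsWhiteNoise.integrable_exp_sub (hξ : IsWhiteNoise μ ξ) (h : L2) :
    Integrable (fun ω => Real.exp (ξ h ω - 1 / 2 * ‖h‖ ^ 2)) μ := by
  by_contra hn
  have := hξ.integral_exp_sub h
  rw [integral_undef hn] at this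
  exact zero_ne_one this

lemma IsWhiteNoise.map_orthonormal (hξ : IsWhiteNoise μ ξ) {n : ℕ} {e : Fin n → L2}
    (he : Orthonormal ℝ e) :
    μ.map (fun ω l => ξ (e l) ω) = Measure.pi fun _ => gaussianReal 0 1 := by
  have hG : IsGaussianProcess (fun (p : (_ : Fin n) × Unit) ω => ξ (e p.1) ω) μ :=
    hξ.gaussian.comp_right (fun p : (_ : Fin n) × Unit => e p.1)
  have hi := hG.iIndepFun_of_covariance_eq_zero (X := fun l (_ : Unit) ω => ξ (e l) ω)
    (fun l _ => (hξ.measurable _).aemeasurable)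
    fun l l' hl _ _ => by
      have := hξ.covariance_eq_inner (e l) (e l')
      rw [he.2 hl] at this
      exact this
  have hi2 : iIndepFun (fun l ω => ξ (e l) ω) μ :=
    hi.comp (fun _ f => f ()) fun _ => measurable_pi_apply ()
  rw [(iIndepFun_iff_map_fun_eq_pi_map fun l => (hξ.measurable _).aemeasurable).1 hi2]
  congr 1
  ext1 l
  have := hξ.map_eq_gaussianReal (e l)
  rwa [he.1 l, one_pow, Real.toNNReal_one] at this

/-- Splitting off the component `h'` of `h` orthogonal to the `e_l`: the corresponding factor of
the stochastic exponential is independent of the `ξ (e_l)` and has mean one. -/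
lemma IsWhiteNoise.integral_comp_mul_exp (hξ : IsWhiteNoise μ ξ) {n : ℕ} {e : Fin n → L2}
    (he : Orthonormal ℝ e) {F : (Fin n → ℝ) → ℝ} (hF : Measurable F) (h : L2) :
    ∫ ω, F (fun l => ξ (e l) ω) * Real.exp (ξ h ω - 1 / 2 * ‖h‖ ^ 2) ∂μ
      = ∫ z : Fin n → ℝ, F z * ∏ l, lineHeat 1 (z l - inner ℝ (e l) h) := by
  set a : Fin n → ℝ := fun l => inner ℝ (e l) h with ha
  set p := ∑ l, a l • e l with hp
  set h' := h - p with hh'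
  have horth : ∀ l, inner ℝ (e l) h' = 0 := by
    intro l
    rw [hh', inner_sub_right, hp, he.inner_right_fintype, sub_self]
  have hph' : inner ℝ p h' = 0 := by
    rw [hp, sum_inner]
    simp only [real_inner_smul_left, horth, mul_zero, Finset.sum_const_zero]
  have hnorm : ‖h‖ ^ 2 = ∑ l, a l ^ 2 + ‖h'‖ ^ 2 := by
    have h1 : h = p + h' := by rw [hh']; abel
    have h2 : ‖p‖ ^ 2 = ∑ l, a l ^ 2 := by
      rw [← real_inner_self_eq_norm_sq, hp, he.inner_sum]
      simp [pow_two]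
    conv_lhs => rw [h1]
    rw [@norm_add_sq_real, hph', h2]
    ring
  set F' : (Fin n → ℝ) → ℝ := fun z =>
    F z * Real.exp (∑ l, a l * z l - 1 / 2 * ∑ l, a l ^ 2) with hF'
  have hF'm : Measurable F' := by
    refine hF.mul (Real.measurable_exp.comp (Measurable.sub_const ?_ _))
    exact Finset.measurable_fun_sum _ fun l _ => (measurable_pi_apply l).const_mul _
  have hZm : Measurable fun ω l => ξ (e l) ω := measurable_pi_lambda _ fun l => hξ.measurable _
  have hind : IndepFun (fun ω l => ξ (e l) ω) (fun ω => ξ h' ω) μ := by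
    have hG : IsGaussianProcess (Sum.elim (fun l => ξ (e l)) (fun _ : Unit => ξ h')) μ := by
      have := hξ.gaussian.comp_right (Sum.elim e (fun _ : Unit => h'))
      rw [Sum.comp_elim] at this
      exact this
    have := hG.indepFun_of_covariance_eq_zero (fun l => (hξ.measurable _).aemeasurable)
      (fun _ => (hξ.measurable _).aemeasurable)
      fun l _ => by rw [hξ.covariance_eq_inner, horth]
    exact this.comp measurable_id (measurable_pi_apply ())
  have hae : ∀ᵐ ω ∂μ, F (fun l => ξ (e l) ω) * Real.exp (ξ h ω - 1 / 2 * ‖h‖ ^ 2)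
      = F' (fun l => ξ (e l) ω) * Real.exp (ξ h' ω - 1 / 2 * ‖h'‖ ^ 2) := by
    filter_upwards [hξ.ae_sub h p, hξ.ae_sum_smul a e] with ω h1 h2
    rw [← hp] at h2
    rw [← hh', h2] at h1
    simp only [hF']
    rw [mul_assoc, ← Real.exp_add, h1, hnorm]
    congr 2
    ring
  rw [integral_congr_ae hae, hind.integral_fun_comp_mul_comp hZm.aemeasurable
    (hξ.measurable _).aemeasurable (g := fun x => Real.exp (x - 1 / 2 * ‖h'‖ ^ 2))
    hF'm.aestronglyMeasurable (by fun_prop), hξ.integral_exp_sub, mul_one,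
    ← integral_map (φ := fun ω l => ξ (e l) ω) (f := F') hZm.aemeasurable
      hF'm.aestronglyMeasurable, hξ.map_orthonormal he, pi_gaussianReal_eq_withDensity,
    integral_withDensity_eq_integral_toReal_smul (by fun_prop)
      (Eventually.of_forall fun _ => ENNReal.ofReal_lt_top)]
  refine integral_congr_ae (Eventually.of_forall fun z => ?_)
  simp only
  rw [ENNReal.toReal_ofReal (Finset.prod_nonneg fun i _ => lineHeat_nonneg _ _), smul_eq_mul]
  simp only [hF']
  rw [mul_left_comm, mul_comm (∏ i, lineHeat 1 (z i)), Finset.mul_sum, ← Finset.sum_sub_distrib,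
    Real.exp_sum, ← Finset.prod_mul_distrib]
  congr 1
  refine Finset.prod_congr rfl fun l _ => ?_
  unfold lineHeat
  rw [mul_left_comm, ← Real.exp_add]
  congr 2
  ring

open Matrix in
/-- The Fourier-Wiener transform of a product of one-dimensional heat kernels at linearly
independent `v i` is bounded, and converges, as the kernels approach `δ₀`, to the density at `0`
of the Gaussian vector `(ξ (v i))` under the measure tilted by `h`. -/
lemma IsWhiteNoise.integral_prod_lineHeat (hξ : IsWhiteNoise μ ξ) {n : ℕ} {v : Fin n → L2}
    (hv : 0 < (gram ℝ v).det) (h : L2) (U : Submodule ℝ L2) [FiniteDimensional ℝ U]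
    (hU : U = Submodule.span ℝ (Set.range v)) :
    (∀ ε : ℝ, 0 < ε →
      ∫ ω, (∏ i, lineHeat ε (ξ (v i) ω)) * Real.exp (ξ h ω - 1 / 2 * ‖h‖ ^ 2) ∂μ
        ≤ (√(gram ℝ v).det)⁻¹ * (√(2 * Real.pi))⁻¹ ^ n) ∧
    Tendsto (fun ε : ℝ =>
      ∫ ω, (∏ i, lineHeat ε (ξ (v i) ω)) * Real.exp (ξ h ω - 1 / 2 * ‖h‖ ^ 2) ∂μ)
      (𝓝[>] 0) (𝓝 ((√(gram ℝ v).det)⁻¹ * ((√(2 * Real.pi))⁻¹ ^ n *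
        Real.exp (-(1 / 2) * ‖U.starProjection h‖ ^ 2)))) := by
  have hli : LinearIndependent ℝ v := det_gram_ne_zero_iff_linearIndependent.1 hv.ne'
  have hfr : Module.finrank ℝ U = n := by
    rw [hU, finrank_span_eq_card hli, Fintype.card_fin]
  set b : OrthonormalBasis (Fin n) ℝ U := (stdOrthonormalBasis ℝ U).reindex (finCongr hfr)
  have hvU : ∀ i, v i ∈ U := fun i => by
    rw [hU]; exact Submodule.subset_span (Set.mem_range_self i)
  set w : Fin n → U := fun i => ⟨v i, hvU i⟩
  set e : Fin n → L2 := fun l => (b l : L2) with he_def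
  have he : Orthonormal ℝ e := b.orthonormal.comp_linearIsometry U.subtypeₗᵢ
  set M : Matrix (Fin n) (Fin n) ℝ := of fun i l => b.repr (w i) l with hM_def
  have hgram : gram ℝ v = M * Mᵀ := by
    have h1 : gram ℝ v = gram ℝ w := rfl
    rw [h1, gram_eq_conjTranspose_mul b]
    ext i j
    simp [mul_apply, M]
  have hdet : (gram ℝ v).det = M.det ^ 2 := by rw [hgram, det_mul, det_transpose, pow_two]
  have hM : M.det ≠ 0 := fun h0 => by simp [hdet, h0] at hv
  have hsqrt : √(gram ℝ v).det = |M.det| := by rw [hdet, Real.sqrt_sq_eq_abs]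
  have hvM : ∀ i, v i = ∑ l, M i l • e l := by
    intro i
    have := congrArg (Subtype.val : U → L2) (b.sum_repr (w i)).symm
    simpa [M, e, w] using this
  have hform : ∀ ε : ℝ, ∫ ω, (∏ i, lineHeat ε (ξ (v i) ω)) *
        Real.exp (ξ h ω - 1 / 2 * ‖h‖ ^ 2) ∂μ
      = ∫ z : Fin n → ℝ, (∏ i, lineHeat ε ((M *ᵥ z) i)) *
        ∏ l, lineHeat 1 (z l - inner ℝ (e l) h) := by
    intro ε
    have hc : ∀ i, Continuous fun z : Fin n → ℝ => (M *ᵥ z) i := fun i =>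
      (continuous_apply i).comp (Continuous.matrix_mulVec continuous_const continuous_id)
    have hF : Measurable fun z : Fin n → ℝ => ∏ i, lineHeat ε ((M *ᵥ z) i) := by
      refine Continuous.measurable ?_
      fun_prop
    rw [← hξ.integral_comp_mul_exp he hF h]
    refine integral_congr_ae ?_
    have hlin : ∀ᵐ ω ∂μ, ∀ i, ξ (v i) ω = ∑ l, M i l * ξ (e l) ω :=
      eventually_all.2 fun i => by
        rw [hvM i]; exact hξ.ae_sum_smul (M i) e
    filter_upwards [hlin] with ω hω
    simp only [hω]
    rfl
  have hproj : ‖U.starProjection h‖ ^ 2 = ∑ l, inner ℝ (e l) h ^ 2 := by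
    rw [Submodule.starProjection_apply]
    change ‖U.orthogonalProjectionOnto h‖ ^ 2 = _
    rw [← b.sum_sq_norm_inner_right]
    refine Finset.sum_congr rfl fun l _ => ?_
    rw [Real.norm_eq_abs, sq_abs, Submodule.inner_orthogonalProjectionOnto_eq_of_mem_left]
  rw [hsqrt, hproj]
  constructor
  · intro ε hε
    rw [hform]
    exact integral_prod_lineHeat_mulVec_le M hM _ hε
  · simp only [hform]
    exact tendsto_integral_prod_lineHeat_mulVec M hM _

end WhiteNoise

/-! ### The approximating local times and their transforms -/

lemma heat_nonneg {ε : ℝ} (hε : 0 < ε) (z : Plane) : 0 ≤ heat ε z := by unfold heat; positivity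

lemma heat_le {ε : ℝ} (hε : 0 < ε) (z : Plane) : heat ε z ≤ 1 / (2 * Real.pi * ε) := by
  refine mul_le_of_le_one_right (by positivity) (Real.exp_le_one_iff.2 ?_)
  exact div_nonpos_of_nonpos_of_nonneg (by nlinarith [sq_nonneg ‖z‖]) (by positivity)

lemma approxIntegrand_nonneg {ε : ℝ} (hε : 0 < ε) (y : ℝ → Plane) {k : ℕ} (t : Fin k → ℝ) :
    0 ≤ approxIntegrand ε y t := Finset.prod_nonneg fun _ _ => heat_nonneg hε _

lemma approxIntegrand_le {ε : ℝ} (hε : 0 < ε) (y : ℝ → Plane) {k : ℕ} (t : Fin k → ℝ) :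
    approxIntegrand ε y t ≤ (1 / (2 * Real.pi * ε)) ^ (k - 1) :=
  (Finset.prod_le_prod (fun _ _ => heat_nonneg hε _) fun _ _ => heat_le hε _).trans
    (le_of_eq (by simp))

lemma norm_approxIntegrand_le {ε : ℝ} (hε : 0 < ε) (y : ℝ → Plane) {k : ℕ} (t : Fin k → ℝ) :
    ‖approxIntegrand ε y t‖ ≤ (1 / (2 * Real.pi * ε)) ^ (k - 1) := by
  rw [Real.norm_of_nonneg (approxIntegrand_nonneg hε y t)]
  exact approxIntegrand_le hε y t

lemma norm_approxSILT_le {Ω : Type*} (x : ℝ → Ω → Plane) (k : ℕ) (δ : ℝ) {ε : ℝ} (hε : 0 < ε) (ω : Ω) :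
    ‖approxSILT x k δ ε ω‖
      ≤ (1 / (2 * Real.pi * ε)) ^ (k - 1) * volume.real (offDiag k δ) :=
  norm_setIntegral_le_of_norm_le_const (volume_offDiag_lt_top k δ)
    fun t _ => norm_approxIntegrand_le hε _ t

lemma stochExp_eq_mul {Ω : Type*} (ξ₁ ξ₂ : L2 → Ω → ℝ) (h₁ h₂ : L2) (ω : Ω) : stochExp ξ₁ ξ₂ h₁ h₂ ω
    = Real.exp (ξ₁ h₁ ω - 1 / 2 * ‖h₁‖ ^ 2) * Real.exp (ξ₂ h₂ ω - 1 / 2 * ‖h₂‖ ^ 2) := by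
  rw [stochExp, ← Real.exp_add]
  congr 1
  ring

section Integrator

variable {Ω : Type*} [MeasurableSpace Ω] {μ : Measure Ω} {ξ₁ ξ₂ : L2 → Ω → ℝ}
  {A : L2 →L[ℝ] L2} {x : ℝ → Ω → Plane}

lemma IsPlanarIntegrator.measurable_approxIntegrand (hx : IsPlanarIntegrator μ ξ₁ ξ₂ A x)
    (k : ℕ) (ε : ℝ) :
    Measurable fun p : Ω × (Fin k → ℝ) => approxIntegrand ε (fun s => x s p.1) p.2 := by
  unfold approxIntegrand
  have hheat : Measurable (heat ε) := by
    unfold heat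
    fun_prop
  have hpos : ∀ i : Fin k, Measurable fun p : Ω × (Fin k → ℝ) => x (p.2 i) p.1 := by
    intro i
    have h : Measurable fun p : Ω × (Fin k → ℝ) => (p.2 i, p.1) :=
      ((measurable_pi_apply i).comp measurable_snd).prodMk measurable_fst
    exact hx.measurable.comp h
  exact Finset.measurable_fun_prod _ fun i _ => hheat.comp ((hpos _).sub (hpos _))

lemma IsPlanarIntegrator.integrableOn_approxIntegrand (hx : IsPlanarIntegrator μ ξ₁ ξ₂ A x)
    (k : ℕ) (δ : ℝ) {ε : ℝ} (hε : 0 < ε) (ω : Ω) :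
    IntegrableOn (approxIntegrand ε (fun s => x s ω)) (offDiag k δ) := by
  have hm : Measurable fun t : Fin k → ℝ => approxIntegrand ε (fun s => x s ω) t := by
    have h := (hx.measurable_approxIntegrand k ε).comp (measurable_prodMk_left (x := ω))
    simpa only [Function.comp_def] using h
  exact Measure.integrableOn_of_bounded (volume_offDiag_lt_top k δ).ne hm.aestronglyMeasurable
    (Eventually.of_forall fun t => norm_approxIntegrand_le hε _ t)

lemma IsPlanarIntegrator.stronglyMeasurable_approxSILT (hx : IsPlanarIntegrator μ ξ₁ ξ₂ A x)
    (k : ℕ) (δ ε : ℝ) : StronglyMeasurable (approxSILT x k δ ε) :=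
  (hx.measurable_approxIntegrand k ε).stronglyMeasurable.integral_prod_right

lemma fourierWiener_approxIntegrand_nonneg {ε : ℝ} (hε : 0 < ε) {k : ℕ}
    (t : Fin k → ℝ) (h₁ h₂ : L2) :
    0 ≤ fourierWiener μ ξ₁ ξ₂ (fun ω => approxIntegrand ε (fun s => x s ω) t) h₁ h₂ :=
  integral_nonneg fun _ => mul_nonneg (approxIntegrand_nonneg hε _ t) (Real.exp_nonneg _)

lemma IsPlanarIntegrator.ae_approxIntegrand_eq (hx : IsPlanarIntegrator μ ξ₁ ξ₂ A x)
    (hξ₁ : IsWhiteNoise μ ξ₁) (hξ₂ : IsWhiteNoise μ ξ₂) {ε : ℝ} (hε : 0 < ε) {k : ℕ}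
    {t : Fin k → ℝ} (ht : ∀ i, t i ∈ Set.Icc (0 : ℝ) 1) :
    ∀ᵐ ω ∂μ, approxIntegrand ε (fun s => x s ω) t
      = (∏ i, lineHeat ε (ξ₁ (incr A t i) ω)) * ∏ i, lineHeat ε (ξ₂ (incr A t i) ω) := by
  have h1 : ∀ᵐ ω ∂μ, ∀ i, x (t i) ω = !₂[ξ₁ (gfun A (t i)) ω, ξ₂ (gfun A (t i)) ω] :=
    eventually_all.2 fun i => hx.version _ (ht i)
  have h2 : ∀ᵐ ω ∂μ, ∀ i, ξ₁ (incr A t i) ω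
      = ξ₁ (gfun A (t (hi i))) ω - ξ₁ (gfun A (t (lo i))) ω :=
    eventually_all.2 fun i => hξ₁.ae_sub _ _
  have h3 : ∀ᵐ ω ∂μ, ∀ i, ξ₂ (incr A t i) ω
      = ξ₂ (gfun A (t (hi i))) ω - ξ₂ (gfun A (t (lo i))) ω :=
    eventually_all.2 fun i => hξ₂.ae_sub _ _
  filter_upwards [h1, h2, h3] with ω e1 e2 e3
  rw [approxIntegrand, ← Finset.prod_mul_distrib]
  refine Finset.prod_congr rfl fun i _ => ?_
  rw [heat_eq_mul hε, e1, e1, e2, e3]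
  simp

/-- At fixed times the transform factors over the two independent noises. -/
lemma IsPlanarIntegrator.fourierWiener_approxIntegrand (hx : IsPlanarIntegrator μ ξ₁ ξ₂ A x)
    (hξ₁ : IsWhiteNoise μ ξ₁) (hξ₂ : IsWhiteNoise μ ξ₂) (hind : IndepNoises μ ξ₁ ξ₂)
    {ε : ℝ} (hε : 0 < ε) {k : ℕ} {t : Fin k → ℝ} (ht : ∀ i, t i ∈ Set.Icc (0 : ℝ) 1)
    (h₁ h₂ : L2) :
    fourierWiener μ ξ₁ ξ₂ (fun ω => approxIntegrand ε (fun s => x s ω) t) h₁ h₂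
      = (∫ ω, (∏ i, lineHeat ε (ξ₁ (incr A t i) ω)) *
          Real.exp (ξ₁ h₁ ω - 1 / 2 * ‖h₁‖ ^ 2) ∂μ) *
        ∫ ω, (∏ i, lineHeat ε (ξ₂ (incr A t i) ω)) *
          Real.exp (ξ₂ h₂ ω - 1 / 2 * ‖h₂‖ ^ 2) ∂μ := by
  set Φ : L2 → (L2 → ℝ) → ℝ := fun h f =>
    (∏ i, lineHeat ε (f (incr A t i))) * Real.exp (f h - 1 / 2 * ‖h‖ ^ 2) with hΦ
  have hm : ∀ h : L2, Measurable (Φ h) := by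
    intro h
    have he : ∀ h : L2, Measurable fun f : L2 → ℝ => f h := measurable_pi_apply
    have h1 : ∀ i, Measurable fun f : L2 → ℝ => lineHeat ε (f (incr A t i)) := fun i =>
      (continuous_lineHeat ε).measurable.comp (he _)
    have h2 : Measurable fun f : L2 → ℝ => Real.exp (f h - 1 / 2 * ‖h‖ ^ 2) :=
      Real.measurable_exp.comp ((he h).sub_const _)
    exact (Finset.measurable_fun_prod _ fun i _ => h1 i).mul h2
  have hprod := IndepFun.integral_fun_comp_mul_comp (f := Φ h₁) (g := Φ h₂) hind
    (measurable_pi_lambda _ hξ₁.measurable).aemeasurable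
    (measurable_pi_lambda _ hξ₂.measurable).aemeasurable
    (hm h₁).aestronglyMeasurable (hm h₂).aestronglyMeasurable
  refine Eq.trans ?_ hprod
  refine integral_congr_ae ?_
  filter_upwards [hx.ae_approxIntegrand_eq hξ₁ hξ₂ hε ht] with ω h
  rw [h, stochExp_eq_mul]
  simp only [hΦ]
  ring

variable [IsProbabilityMeasure μ]

lemma integrable_stochExp (hξ₁ : IsWhiteNoise μ ξ₁) (hξ₂ : IsWhiteNoise μ ξ₂)
    (hind : IndepNoises μ ξ₁ ξ₂) (h₁ h₂ : L2) : Integrable (stochExp ξ₁ ξ₂ h₁ h₂) μ := by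
  have hm : ∀ h : L2, Measurable fun f : L2 → ℝ => Real.exp (f h - 1 / 2 * ‖h‖ ^ 2) := by
    intro h
    have : Measurable fun f : L2 → ℝ => f h := measurable_pi_apply h
    fun_prop
  have hI : IndepFun (fun ω => Real.exp (ξ₁ h₁ ω - 1 / 2 * ‖h₁‖ ^ 2))
      (fun ω => Real.exp (ξ₂ h₂ ω - 1 / 2 * ‖h₂‖ ^ 2)) μ := by
    have := IndepFun.comp hind (hm h₁) (hm h₂)
    exact this
  exact (hI.integrable_mul (hξ₁.integrable_exp_sub h₁) (hξ₂.integrable_exp_sub h₂)).congr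
    (Eventually.of_forall fun ω => (stochExp_eq_mul ξ₁ ξ₂ h₁ h₂ ω).symm)

lemma IsPlanarIntegrator.integrable_approxSILT_mul (hx : IsPlanarIntegrator μ ξ₁ ξ₂ A x)
    (hξ₁ : IsWhiteNoise μ ξ₁) (hξ₂ : IsWhiteNoise μ ξ₂) (hind : IndepNoises μ ξ₁ ξ₂)
    (k : ℕ) (δ : ℝ) {ε : ℝ} (hε : 0 < ε) (h₁ h₂ : L2) :
    Integrable (fun ω => approxSILT x k δ ε ω * stochExp ξ₁ ξ₂ h₁ h₂ ω) μ :=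
  (integrable_stochExp hξ₁ hξ₂ hind h₁ h₂).bdd_mul
    (hx.stronglyMeasurable_approxSILT k δ ε).aestronglyMeasurable
    (Eventually.of_forall fun ω => norm_approxSILT_le x k δ hε ω)

lemma IsPlanarIntegrator.integrable_prod_approxIntegrand_mul
    (hx : IsPlanarIntegrator μ ξ₁ ξ₂ A x) (hξ₁ : IsWhiteNoise μ ξ₁) (hξ₂ : IsWhiteNoise μ ξ₂)
    (hind : IndepNoises μ ξ₁ ξ₂) (k : ℕ) (δ : ℝ) {ε : ℝ} (hε : 0 < ε) (h₁ h₂ : L2) :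
    Integrable (fun p : Ω × (Fin k → ℝ) =>
      approxIntegrand ε (fun s => x s p.1) p.2 * stochExp ξ₁ ξ₂ h₁ h₂ p.1)
      (μ.prod (volume.restrict (offDiag k δ))) := by
  have : IsFiniteMeasure (volume.restrict (offDiag k δ)) :=
    ⟨by rw [Measure.restrict_apply_univ]; exact volume_offDiag_lt_top k δ⟩
  exact ((integrable_stochExp hξ₁ hξ₂ hind h₁ h₂).comp_fst _).bdd_mul
    (hx.measurable_approxIntegrand k ε).aestronglyMeasurable
    (Eventually.of_forall fun p => norm_approxIntegrand_le hε _ p.2)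

lemma IsPlanarIntegrator.fourierWiener_approxSILT (hx : IsPlanarIntegrator μ ξ₁ ξ₂ A x)
    (hξ₁ : IsWhiteNoise μ ξ₁) (hξ₂ : IsWhiteNoise μ ξ₂) (hind : IndepNoises μ ξ₁ ξ₂)
    (k : ℕ) (δ : ℝ) {ε : ℝ} (hε : 0 < ε) (h₁ h₂ : L2) :
    fourierWiener μ ξ₁ ξ₂ (approxSILT x k δ ε) h₁ h₂
      = ∫ t in offDiag k δ, fourierWiener μ ξ₁ ξ₂
          (fun ω => approxIntegrand ε (fun s => x s ω) t) h₁ h₂ := by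
  unfold fourierWiener approxSILT
  rw [← integral_integral_swap
    (hx.integrable_prod_approxIntegrand_mul hξ₁ hξ₂ hind k δ hε h₁ h₂)]
  simp only [integral_mul_const]

lemma inv_sqrt_mul_inv_sqrt_two_pi {G : ℝ} (hG : 0 ≤ G) (n : ℕ) :
    ((√G)⁻¹ * (√(2 * Real.pi))⁻¹ ^ n) * ((√G)⁻¹ * (√(2 * Real.pi))⁻¹ ^ n)
      = 1 / ((2 * Real.pi) ^ n * G) := by
  rw [mul_mul_mul_comm, ← mul_inv, Real.mul_self_sqrt hG, ← mul_pow, ← mul_inv,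
    Real.mul_self_sqrt (by positivity), inv_pow, one_div, mul_inv, mul_comm]

lemma IsPlanarIntegrator.fourierWiener_approxIntegrand_le (hx : IsPlanarIntegrator μ ξ₁ ξ₂ A x)
    (hξ₁ : IsWhiteNoise μ ξ₁) (hξ₂ : IsWhiteNoise μ ξ₂) (hind : IndepNoises μ ξ₁ ξ₂)
    {ε : ℝ} (hε : 0 < ε) {k : ℕ} {t : Fin k → ℝ} (ht : ∀ i, t i ∈ Set.Icc (0 : ℝ) 1)
    (hG : 0 < gramDet A t) (h₁ h₂ : L2) :
    fourierWiener μ ξ₁ ξ₂ (fun ω => approxIntegrand ε (fun s => x s ω) t) h₁ h₂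
      ≤ 1 / ((2 * Real.pi) ^ (k - 1) * gramDet A t) := by
  rw [hx.fourierWiener_approxIntegrand hξ₁ hξ₂ hind hε ht,
    ← inv_sqrt_mul_inv_sqrt_two_pi hG.le]
  refine mul_le_mul ((hξ₁.integral_prod_lineHeat hG h₁ (incrSpan A t) rfl).1 ε hε)
    ((hξ₂.integral_prod_lineHeat hG h₂ (incrSpan A t) rfl).1 ε hε) ?_ (by positivity)
  exact integral_nonneg fun _ =>
    mul_nonneg (Finset.prod_nonneg fun _ _ => lineHeat_nonneg _ _) (Real.exp_nonneg _)

lemma IsPlanarIntegrator.tendsto_fourierWiener_approxIntegrand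
    (hx : IsPlanarIntegrator μ ξ₁ ξ₂ A x)
    (hξ₁ : IsWhiteNoise μ ξ₁) (hξ₂ : IsWhiteNoise μ ξ₂) (hind : IndepNoises μ ξ₁ ξ₂)
    {k : ℕ} {t : Fin k → ℝ} (ht : ∀ i, t i ∈ Set.Icc (0 : ℝ) 1)
    (hG : 0 < gramDet A t) (h₁ h₂ : L2) :
    Tendsto (fun ε : ℝ =>
      fourierWiener μ ξ₁ ξ₂ (fun ω => approxIntegrand ε (fun s => x s ω) t) h₁ h₂)
      (𝓝[>] 0) (𝓝 (formalIntegrand A h₁ h₂ t)) := by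
  have h := (hξ₁.integral_prod_lineHeat hG h₁ (incrSpan A t) rfl).2.mul
    (hξ₂.integral_prod_lineHeat hG h₂ (incrSpan A t) rfl).2
  have hlim : formalIntegrand A h₁ h₂ t =
      ((√(gramDet A t))⁻¹ * ((√(2 * Real.pi))⁻¹ ^ (k - 1) *
        Real.exp (-(1 / 2) * ‖(incrSpan A t).starProjection h₁‖ ^ 2))) *
      ((√(gramDet A t))⁻¹ * ((√(2 * Real.pi))⁻¹ ^ (k - 1) *
        Real.exp (-(1 / 2) * ‖(incrSpan A t).starProjection h₂‖ ^ 2))) := by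
    rw [formalIntegrand, mul_add, Real.exp_add, ← inv_sqrt_mul_inv_sqrt_two_pi hG.le]
    ring
  rw [hlim]
  refine h.congr' ?_
  filter_upwards [self_mem_nhdsWithin] with ε hε
  exact (hx.fourierWiener_approxIntegrand hξ₁ hξ₂ hind hε ht h₁ h₂).symm

end Integrator

end SILT

end

theorem theorem4 {Ω : Type*} [MeasurableSpace Ω] (μ : Measure Ω) [IsProbabilityMeasure μ]
    (ξ₁ ξ₂ : SILT.L2 → Ω → ℝ)
    (hξ₁ : SILT.IsWhiteNoise μ ξ₁) (hξ₂ : SILT.IsWhiteNoise μ ξ₂)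
    (hind : SILT.IndepNoises μ ξ₁ ξ₂)
    (A : SILT.L2 →L[ℝ] SILT.L2)
    (hA₁ : FiniteDimensional ℝ (LinearMap.ker (A : SILT.L2 →ₗ[ℝ] SILT.L2)))
    (hA₂ : SILT.InvertibleOffKernel A)
    (x : ℝ → Ω → SILT.Plane) (hx : SILT.IsPlanarIntegrator μ ξ₁ ξ₂ A x)
    (k : ℕ) (hk : 2 ≤ k) (δ : ℝ) (hδ : 0 < δ) :
    -- the approximations are genuine square integrable random variables with a transform
    (∀ ε : ℝ, 0 < ε →
      (∀ ω, IntegrableOn (SILT.approxIntegrand ε (fun s => x s ω)) (SILT.offDiag k δ)) ∧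
      MemLp (SILT.approxSILT x k δ ε) 2 μ ∧
      ∀ h₁ h₂ : SILT.L2,
        Integrable (fun ω => SILT.approxSILT x k δ ε ω * SILT.stochExp ξ₁ ξ₂ h₁ h₂ ω) μ) ∧
    -- the denominator vanishes only on a null set of the domain off the diagonals
    (∀ᵐ t ∂(volume.restrict (SILT.offDiag k δ)), 0 < SILT.gramDet A t) ∧
    -- the integral over this domain converges and is the limit of the transforms
    ∀ h₁ h₂ : SILT.L2,
      IntegrableOn (SILT.formalIntegrand A h₁ h₂) (SILT.offDiag k δ) ∧
      Tendsto
        (fun ε : ℝ => SILT.fourierWiener μ ξ₁ ξ₂ (SILT.approxSILT x k δ ε) h₁ h₂)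
        (𝓝[>] 0)
        (𝓝 (∫ t in SILT.offDiag k δ, SILT.formalIntegrand A h₁ h₂ t)) := by
  obtain ⟨n, rfl⟩ : ∃ n, k = n + 1 := ⟨k - 1, by omega⟩
  obtain ⟨H, hH, hae⟩ := SILT.exists_integrableOn_inv_gramDet_le A hA₁ hA₂ hδ n
  refine ⟨fun ε hε => ⟨fun ω => hx.integrableOn_approxIntegrand _ δ hε ω, ?_, fun h₁ h₂ =>
    hx.integrable_approxSILT_mul hξ₁ hξ₂ hind _ δ hε h₁ h₂⟩, hae.mono fun t ht => ht.1, ?_⟩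
  · exact MemLp.of_bound (hx.stronglyMeasurable_approxSILT _ δ ε).aestronglyMeasurable _
      (Eventually.of_forall fun ω => SILT.norm_approxSILT_le x _ δ hε ω)
  intro h₁ h₂
  set D := SILT.offDiag (n + 1) δ with hD
  have hmem : ∀ᵐ t ∂(volume.restrict D), t ∈ D :=
    ae_restrict_mem (SILT.measurableSet_offDiag _ _)
  have hbound : ∀ t, (SILT.gramDet A t)⁻¹ ≤ H t →
      1 / ((2 * Real.pi) ^ n * SILT.gramDet A t) ≤ ((2 * Real.pi) ^ n)⁻¹ * H t := by
    intro t ht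
    rw [one_div, mul_inv]
    exact mul_le_mul_of_nonneg_left ht (by positivity)
  have hmeas : ∀ ε : ℝ, 0 < ε → AEStronglyMeasurable (fun t => SILT.fourierWiener μ ξ₁ ξ₂
      (fun ω => SILT.approxIntegrand ε (fun s => x s ω) t) h₁ h₂) (volume.restrict D) :=
    fun ε hε => (hx.integrable_prod_approxIntegrand_mul hξ₁ hξ₂ hind (n + 1) δ hε h₁
      h₂).integral_prod_right.aestronglyMeasurable
  have hlim : ∀ᵐ t ∂(volume.restrict D), Tendsto (fun ε : ℝ => SILT.fourierWiener μ ξ₁ ξ₂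
      (fun ω => SILT.approxIntegrand ε (fun s => x s ω) t) h₁ h₂) (𝓝[>] 0)
      (𝓝 (SILT.formalIntegrand A h₁ h₂ t)) := by
    filter_upwards [hae, hmem] with t ht htD
    exact hx.tendsto_fourierWiener_approxIntegrand hξ₁ hξ₂ hind htD.1.1 ht.1 h₁ h₂
  have hdom : ∀ ε : ℝ, 0 < ε → ∀ᵐ t ∂(volume.restrict D), ‖SILT.fourierWiener μ ξ₁ ξ₂
      (fun ω => SILT.approxIntegrand ε (fun s => x s ω) t) h₁ h₂‖
        ≤ ((2 * Real.pi) ^ n)⁻¹ * H t := by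
    intro ε hε
    filter_upwards [hae, hmem] with t ht htD
    rw [Real.norm_of_nonneg (SILT.fourierWiener_approxIntegrand_nonneg hε t h₁ h₂)]
    exact (hx.fourierWiener_approxIntegrand_le hξ₁ hξ₂ hind hε htD.1.1 ht.1 h₁ h₂).trans
      (hbound t ht.2)
  constructor
  · refine (hH.const_mul ((2 * Real.pi) ^ n)⁻¹).mono' ?_ ?_
    -- the formal integrand is measurable as an almost everywhere limit of measurable transforms
    · have hseq : Tendsto (fun m : ℕ => (1 / (m + 1) : ℝ)) atTop (𝓝[>] 0) :=
        tendsto_nhdsWithin_iff.2 ⟨tendsto_one_div_add_atTop_nhds_zero_nat,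
          Eventually.of_forall fun m => by simp only [Set.mem_Ioi]; positivity⟩
      exact aestronglyMeasurable_of_tendsto_ae atTop
        (fun m : ℕ => hmeas (1 / (m + 1)) (by positivity))
        (hlim.mono fun t ht => ht.comp hseq)
    · filter_upwards [hae] with t ht
      have h0 : 0 < SILT.gramDet A t := ht.1
      refine le_trans ?_ (hbound t ht.2)
      rw [Real.norm_of_nonneg (by unfold SILT.formalIntegrand; positivity)]
      refine mul_le_of_le_one_right (by positivity) (Real.exp_le_one_iff.2 ?_)
      exact mul_nonpos_of_nonpos_of_nonneg (by norm_num) (by positivity)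
  · have key := tendsto_integral_filter_of_dominated_convergence
      (fun t => ((2 * Real.pi) ^ n)⁻¹ * H t)
      (by filter_upwards [self_mem_nhdsWithin] with ε hε using hmeas ε hε)
      (by filter_upwards [self_mem_nhdsWithin] with ε hε using hdom ε hε)
      (hH.const_mul _) hlim
    refine key.congr' ?_
    filter_upwards [self_mem_nhdsWithin] with ε hε
    exact (hx.fourierWiener_approxSILT hξ₁ hξ₂ hind (n + 1) δ hε h₁ h₂).symm
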